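/- Let $P$ be a finite set of qubits, $V=\mathbb F_2\oplus\mathbb F_2$ with base $(z,x)$ and its symplectic form, and let $L\subset V^P$ be a subspace on which the induced symplectic form $\omega$ of $V^P$ vanishes identically. For $S\subset P$ put $L_S=\{v\in L\mid v_p=0 \text{ for all } p\notin S\}$, and assume that $L$ does not split off a zero factor, i.e. there is no nonempty $S\subset P$ with $L=L_S\oplus L_{P\setminus S}$ and $L_S=0$. Let $\tilde V^P\subset U((\mathbb C^2)^{\otimes P})$ be the Pauli group, generated by the unitary scalars and all tensor products of Pauli operators, with its natural projection to $V^P$ (whose kernel consists of the scalars), let $\sigma\colon L\to\tilde V^P$ be any homomorphic section of this projection over $L$, and let $C=C(L,\sigma)\subset(\mathbb C^2)^{\otimes P}$ be the common fixed space of the operators $\sigma(v)$, $v\in L$. Identify $U(2)/S^1$ with $SO(3)$ by the adjoint action on traceless Hermitian operators. Let $A(L,\sigma)$ be the group of all $g\in SO(3)^P$ such that, for some $\tilde g\in U(2)^P$ representing $g$, the operator $\bigotimes_p\tilde g_p$ maps $C$ into itself, and let $Z(L,\sigma)$ be the normal subgroup of those $g$ for which moreover $\bigotimes_p\tilde g_p$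 acts on $C$ as a scalar for some such $\tilde g$. Then the group $\overline A(L,\sigma)=A(L,\sigma)/Z(L,\sigma)$ of transversally realisable logical operators, with its quotient topology, is a solvable compact Lie group. In particular, no universal set of gates on even one logical qubit can be realised transversally, not even approximately: let $d=|P|-\dim L$, let $\varphi\colon C\to(\mathbb C^2)^{\otimes d}$ be any linear isomorphism, let $j\in\{1,\dots,d\}$, and let $\mathcal G\subset U((\mathbb C^2)^{\otimes d})$ be a set such that the closure of the group generated by $\mathcal G$ and the unitary scalars contains every operator that acts as some $u\in U(2)$ on the $j$-th factor and as the identity on the other factors. Then there is $W\in\mathcal G$ that has no approximate transversal realisations; that is, for some $\varepsilon>0$ there are no $\tilde g\in U(2)^P$ and $c\in\mathbb C$ with $|c|=1$ such that $$\Bigl\|\bigotimes_p\tilde g_p\,\psi-c\,\varphi^{-1}W\varphi\,\psi\Bigr\|\le\varepsilon\|\psi\|\quad\text{for all }\psi\in C.$$ -/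

import Mathlib

open scoped ContDiff Manifold

noncomputable section

namespace StabCode

/-! ### Binary symplectic geometry -/

/-- The plane `V = 𝔽₂ ⊕ 𝔽₂`; the coordinates refer to the standard base `(z, x)`. -/
abbrev V : Type := ZMod 2 × ZMod 2

section Symplectic

variable {P : Type*}

/-- The symplectic form on `V ^ P`, the sum over all qubits of the symplectic form of `V`. -/
def omega [Fintype P] (v w : P → V) : ZMod 2 :=
  ∑ p, ((v p).1 * (w p).2 - (v p).2 * (w p).1)

/-- `L` is isotropic: the symplectic form vanishes identically on `L × L`. -/
def IsIsotropic [Fintype P] (L : Submodule (ZMod 2) (P → V)) : Prop :=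
  ∀ v ∈ L, ∀ w ∈ L, omega v w = 0

/-- `V ^ S` as the subspace of all vectors of `V ^ P` that vanish outside `S`. -/
def supportedOn (S : Set P) : Submodule (ZMod 2) (P → V) where
  carrier := {v | ∀ p, p ∉ S → v p = 0}
  add_mem' {v w} hv hw p hp := by simp [hv p hp, hw p hp]
  zero_mem' _ _ := rfl
  smul_mem' c v hv p hp := by simp [hv p hp]

/-- `L_S = L ∩ V ^ S`. -/
def part (L : Submodule (ZMod 2) (P → V)) (S : Set P) : Submodule (ZMod 2) (P → V) :=
  L ⊓ supportedOn S

/-- `L` splits off a zero factor: for some nonempty set `S` of qubits, `L` is the direct product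
of `L_S` and `L_{P \ S}`, and `L_S = 0`. The set `S` may be all of `P`, in which case `L = 0`. -/
def SplitsOffZeroFactor (L : Submodule (ZMod 2) (P → V)) : Prop :=
  ∃ S : Set P, S.Nonempty ∧ L = part L S ⊔ part L Sᶜ ∧ part L S = ⊥

end Symplectic

/-! ### The state space and local operators -/

/-- The unitary group `U(2)`. -/
abbrev U2 : Type := Matrix.unitaryGroup (Fin 2) ℂ

/-- The rotation group `SO(3)`. -/
abbrev SO3 : Type := Matrix.specialOrthogonalGroup (Fin 3) ℝ

section Operators

variable {P : Type*} [Fintype P]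

/-- The state space `(ℂ²)^{⊗ P}`, written in its computational (orthonormal) basis, which is
indexed by the bit strings `P → Fin 2`. -/
abbrev StateSpace (P : Type*) [Fintype P] : Type _ := EuclideanSpace ℂ (P → Fin 2)

/-- The unitary group of the state space. -/
abbrev UnitaryOn (P : Type*) [Fintype P] [DecidableEq P] : Type _ :=
  Matrix.unitaryGroup (P → Fin 2) ℂ

/-- The matrix of the tensor product of one-qubit operators. -/
def tensorMat (M : P → Matrix (Fin 2) (Fin 2) ℂ) : Matrix (P → Fin 2) (P → Fin 2) ℂ :=
  Matrix.of fun a b => ∏ p, M p (a p) (b p)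

theorem tensorMat_one : tensorMat (1 : P → Matrix (Fin 2) (Fin 2) ℂ) = 1 := by
  ext a b
  simp only [tensorMat, Matrix.of_apply, Pi.one_apply]
  by_cases h : a = b
  · subst h; simp
  · obtain ⟨p, hp⟩ := Function.ne_iff.mp h
    rw [Matrix.one_apply_ne h]
    exact Finset.prod_eq_zero (Finset.mem_univ p) (Matrix.one_apply_ne hp)

theorem tensorMat_star (M : P → Matrix (Fin 2) (Fin 2) ℂ) :
    star (tensorMat M) = tensorMat (star M) := by
  ext a b
  simp [tensorMat, Matrix.star_apply]

variable [DecidableEq P]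

theorem tensorMat_mul (M N : P → Matrix (Fin 2) (Fin 2) ℂ) :
    tensorMat (M * N) = tensorMat M * tensorMat N := by
  ext a b
  simp only [tensorMat, Matrix.of_apply, Matrix.mul_apply, Pi.mul_apply]
  rw [Fintype.prod_sum]
  exact Finset.sum_congr rfl fun c _ => Finset.prod_mul_distrib

/-- The local unitary operator `⨂ u_p` on the state space given by a family `u ∈ U(2)^P`. -/
def tensorU : (P → U2) →* UnitaryOn P where
  toFun u := ⟨tensorMat fun p => (u p : Matrix (Fin 2) (Fin 2) ℂ), by
    rw [Matrix.mem_unitaryGroup_iff, tensorMat_star, ← tensorMat_mul, ← tensorMat_one]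
    congr 1
    funext p
    exact Matrix.mem_unitaryGroup_iff.mp (u p).2⟩
  map_one' := Subtype.ext tensorMat_one
  map_mul' u w := Subtype.ext (tensorMat_mul _ _)

/-- The action of a unitary matrix on state vectors. -/
def act (U : UnitaryOn P) : StateSpace P →ₗ[ℂ] StateSpace P :=
  Matrix.toEuclideanLin (U : Matrix (P → Fin 2) (P → Fin 2) ℂ)

theorem act_one : act (1 : UnitaryOn P) = LinearMap.id := by
  ext ψ a
  simp [act]

theorem act_mul (U W : UnitaryOn P) : act (U * W) = act U ∘ₗ act W := by
  ext ψ a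
  simp [act, Matrix.mulVec_mulVec]

theorem act_inv_act (U : UnitaryOn P) (ψ : StateSpace P) : act U⁻¹ (act U ψ) = ψ := by
  rw [← LinearMap.comp_apply, ← act_mul, inv_mul_cancel, act_one, LinearMap.id_apply]

/-! ### The Pauli group -/

/-- The Pauli operator `X`. -/
def pauliX : Matrix (Fin 2) (Fin 2) ℂ := !![0, 1; 1, 0]

/-- The Pauli operator `Y`. -/
def pauliY : Matrix (Fin 2) (Fin 2) ℂ := !![0, -Complex.I; Complex.I, 0]

/-- The Pauli operator `Z`. -/
def pauliZ : Matrix (Fin 2) (Fin 2) ℂ := !![1, 0; 0, -1]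

/-- The Pauli operator `Z ^ a * X ^ b` that represents the vector `a z + b x` of `V`; it is the
identity, `Z`, `X` or `Z X = i Y`. -/
def pauliOf (v : V) : Matrix (Fin 2) (Fin 2) ℂ := pauliZ ^ v.1.val * pauliX ^ v.2.val

/-- `U` is a scalar multiple of the tensor product of Pauli operators given by `v ∈ V ^ P`. -/
def LiesOver (U : UnitaryOn P) (v : P → V) : Prop :=
  ∃ c : ℂ, (U : Matrix (P → Fin 2) (P → Fin 2) ℂ) = c • tensorMat fun p => pauliOf (v p)

/-- The Pauli group, generated by all tensor products of Pauli operators and all (unitary)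
scalars. -/
def pauliGroup (P : Type*) [Fintype P] [DecidableEq P] : Subgroup (UnitaryOn P) :=
  Subgroup.closure {U | ∃ v : P → V, LiesOver U v}

/-- A section `σ` over `L` of the natural projection from the Pauli group to `V ^ P`: a
homomorphism from the additive group `L` that assigns to each `v ∈ L` a Pauli element over `v`. -/
structure Sec (L : Submodule (ZMod 2) (P → V)) where
  /-- The homomorphism from `L` to the Pauli group. -/
  hom : Multiplicative L →* pauliGroup P
  liesOver : ∀ v : L, LiesOver (hom (Multiplicative.ofAdd v) : UnitaryOn P) v

/-- The stabilizer code `C(L, σ)`: the fixed point space of the stabilizer group `σ(L)`. -/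
def code {L : Submodule (ZMod 2) (P → V)} (σ : Sec L) : Submodule ℂ (StateSpace P) where
  carrier := {ψ | ∀ v : L, act (σ.hom (Multiplicative.ofAdd v) : UnitaryOn P) ψ = ψ}
  add_mem' {ψ χ} hψ hχ v := by rw [map_add, hψ v, hχ v]
  zero_mem' v := map_zero _
  smul_mem' c ψ hψ v := by rw [map_smul, hψ v]

end Operators

/-! ### The identification `U(2) / S¹ = SO(3)` -/

/-- The base `X, Y, Z` of the space of traceless Hermitian operators on `ℂ²`. -/
def pauliBase : Fin 3 → Matrix (Fin 2) (Fin 2) ℂ := ![pauliX, pauliY, pauliZ]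

/-- `u ∈ U(2)` represents the rotation `g ∈ SO(3)`: in the base `X, Y, Z`, the matrix of the
adjoint action `T ↦ u T u⁻¹` on traceless Hermitian operators is `g`. -/
def Represents (u : U2) (g : SO3) : Prop :=
  ∀ j, (u : Matrix (Fin 2) (Fin 2) ℂ) * pauliBase j * star (u : Matrix (Fin 2) (Fin 2) ℂ) =
    ∑ i, ((g : Matrix (Fin 3) (Fin 3) ℝ) i j : ℂ) • pauliBase i

theorem Represents.one : Represents 1 1 := by
  intro j
  simp [Matrix.one_apply]

theorem Represents.mul {u w : U2} {g h : SO3} (hu : Represents u g) (hw : Represents w h) :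
    Represents (u * w) (g * h) := by
  intro j
  have key : ((u * w : U2) : Matrix (Fin 2) (Fin 2) ℂ) * pauliBase j *
      star ((u * w : U2) : Matrix (Fin 2) (Fin 2) ℂ) =
      (u : Matrix (Fin 2) (Fin 2) ℂ) * ((w : Matrix (Fin 2) (Fin 2) ℂ) * pauliBase j *
        star (w : Matrix (Fin 2) (Fin 2) ℂ)) * star (u : Matrix (Fin 2) (Fin 2) ℂ) := by
    simp only [Submonoid.coe_mul, star_mul, mul_assoc]
  rw [key, hw j, Finset.mul_sum, Finset.sum_mul]
  simp only [mul_smul_comm, smul_mul_assoc, hu _, Finset.smul_sum, smul_smul]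
  rw [Finset.sum_comm]
  refine Finset.sum_congr rfl fun i _ => ?_
  rw [← Finset.sum_smul]
  congr 1
  simp only [Submonoid.coe_mul, Matrix.mul_apply, Complex.ofReal_sum, Complex.ofReal_mul]
  exact Finset.sum_congr rfl fun k _ => mul_comm _ _

theorem Represents.inv {u : U2} {g : SO3} (hu : Represents u g) : Represents u⁻¹ g⁻¹ := by
  intro j
  have hg : (g : Matrix (Fin 3) (Fin 3) ℝ) * ((g⁻¹ : SO3) : Matrix (Fin 3) (Fin 3) ℝ) = 1 := by
    rw [← Submonoid.coe_mul, mul_inv_cancel, Submonoid.coe_one]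
  have huu : star (u : Matrix (Fin 2) (Fin 2) ℂ) * (u : Matrix (Fin 2) (Fin 2) ℂ) = 1 :=
    Matrix.mem_unitaryGroup_iff'.mp u.2
  have hsum : (u : Matrix (Fin 2) (Fin 2) ℂ) *
      (∑ i, (((g⁻¹ : SO3) : Matrix (Fin 3) (Fin 3) ℝ) i j : ℂ) • pauliBase i) *
      star (u : Matrix (Fin 2) (Fin 2) ℂ) = pauliBase j := by
    rw [Finset.mul_sum, Finset.sum_mul]
    simp only [mul_smul_comm, smul_mul_assoc, hu _, Finset.smul_sum, smul_smul]
    rw [Finset.sum_comm]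
    have : ∀ k, ∑ i, ((((g⁻¹ : SO3) : Matrix (Fin 3) (Fin 3) ℝ) i j : ℂ) *
        ((g : Matrix (Fin 3) (Fin 3) ℝ) k i : ℂ)) • pauliBase k =
        ((1 : Matrix (Fin 3) (Fin 3) ℝ) k j : ℂ) • pauliBase k := by
      intro k
      rw [← Finset.sum_smul, ← hg, Matrix.mul_apply, Complex.ofReal_sum]
      congr 1
      refine Finset.sum_congr rfl fun i _ => ?_
      rw [Complex.ofReal_mul, mul_comm]
    rw [Finset.sum_congr rfl fun k _ => this k]
    simp [Matrix.one_apply]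
  have hinv : ((u⁻¹ : U2) : Matrix (Fin 2) (Fin 2) ℂ) = star (u : Matrix (Fin 2) (Fin 2) ℂ) := rfl
  rw [hinv, star_star, ← hsum]
  simp only [← mul_assoc, huu, one_mul]
  rw [mul_assoc, huu, mul_one]

/-! ### The automorphism group and the group of logical operators -/

section Automorphisms

variable {P : Type*} [Fintype P] [DecidableEq P] {L : Submodule (ZMod 2) (P → V)}

theorem act_inv_mem (C : Submodule ℂ (StateSpace P)) (U : UnitaryOn P)
    (h : ∀ ψ ∈ C, act U ψ ∈ C) : ∀ ψ ∈ C, act U⁻¹ ψ ∈ C := by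
  intro ψ hψ
  let f : C →ₗ[ℂ] C := (act U).restrict h
  have hinj : Function.Injective f := by
    intro a b hab
    apply Subtype.ext
    have := congrArg (fun c : C => act U⁻¹ (c : StateSpace P)) hab
    simpa [f, LinearMap.restrict_apply, act_inv_act] using this
  obtain ⟨χ, hχ⟩ := LinearMap.injective_iff_surjective.mp hinj ⟨ψ, hψ⟩
  have : act U (χ : StateSpace P) = ψ := congrArg Subtype.val hχ
  rw [← this, act_inv_act]
  exact χ.2

/-- The automorphism group `A(L, σ)` of the code: all `g ∈ SO(3)^P` such that some family in
`U(2)^P` that represents `g` sends the code into itself. -/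
def autGroup (σ : Sec L) : Subgroup (P → SO3) where
  carrier := {g | ∃ u : P → U2, (∀ p, Represents (u p) (g p)) ∧
    ∀ ψ ∈ code σ, act (tensorU u) ψ ∈ code σ}
  mul_mem' := by
    rintro g h ⟨u, hu, hu'⟩ ⟨w, hw, hw'⟩
    refine ⟨u * w, fun p => (hu p).mul (hw p), fun ψ hψ => ?_⟩
    rw [map_mul, act_mul]
    exact hu' _ (hw' _ hψ)
  one_mem' := ⟨1, fun _ => Represents.one, fun ψ hψ => by
    rw [map_one, act_one]; exact hψ⟩
  inv_mem' := by
    rintro g ⟨u, hu, hu'⟩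
    refine ⟨u⁻¹, fun p => (hu p).inv, ?_⟩
    rw [map_inv]
    exact act_inv_mem _ _ hu'

/-- The subgroup `Z(L, σ)` of all automorphisms that act by scalars on the code. -/
def scalarGroup (σ : Sec L) : Subgroup (autGroup σ) where
  carrier := {g | ∃ u : P → U2, (∀ p, Represents (u p) ((g : P → SO3) p)) ∧
    ∃ c : ℂ, ∀ ψ ∈ code σ, act (tensorU u) ψ = c • ψ}
  mul_mem' := by
    rintro g h ⟨u, hu, c, hc⟩ ⟨w, hw, d, hd⟩
    refine ⟨u * w, fun p => (hu p).mul (hw p), d * c, fun ψ hψ => ?_⟩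
    rw [map_mul, act_mul, LinearMap.comp_apply, hd ψ hψ, map_smul, hc ψ hψ, smul_smul]
  one_mem' := ⟨1, fun _ => Represents.one, 1, fun ψ _ => by
    rw [map_one, act_one, one_smul, LinearMap.id_apply]⟩
  inv_mem' := by
    rintro g ⟨u, hu, c, hc⟩
    refine ⟨u⁻¹, fun p => (hu p).inv, c⁻¹, fun ψ hψ => ?_⟩
    have h1 : ψ = c • act (tensorU u)⁻¹ ψ := by
      rw [← map_smul, ← hc ψ hψ, act_inv_act]
    rw [map_inv]
    by_cases h0 : c = 0
    · have h2 : ψ = 0 := by rw [h1, h0, zero_smul]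
      rw [h2, map_zero, smul_zero]
    · conv_rhs => rw [h1]
      rw [smul_smul, inv_mul_cancel₀ h0, one_smul]

instance scalarGroup_normal (σ : Sec L) : (scalarGroup σ).Normal where
  conj_mem := by
    rintro g ⟨u, hu, c, hc⟩ ⟨h, hh⟩
    obtain ⟨w, hw, hw'⟩ := hh
    refine ⟨w * u * w⁻¹, fun p => ((hw p).mul (hu p)).mul (hw p).inv, c, fun ψ hψ => ?_⟩
    have h1 := act_inv_mem _ _ hw' ψ hψ
    have h2 : act (tensorU w) (act (tensorU w)⁻¹ ψ) = ψ := by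
      have := act_inv_act (tensorU w)⁻¹ ψ
      rwa [inv_inv] at this
    rw [map_mul, map_mul, map_inv, act_mul, act_mul, LinearMap.comp_apply, LinearMap.comp_apply,
      hc _ h1, map_smul, h2]

/-- The group `A(L, σ) / Z(L, σ)` of transversally realisable logical operators, up to scalars.
It carries the quotient topology of the subspace topology of `A(L, σ)` in `SO(3)^P`. -/
abbrev LogicalGroup (σ : Sec L) : Type _ := autGroup σ ⧸ scalarGroup σ

end Automorphisms

/-- A topological group is a compact Lie group if it is compact, Hausdorff and second countable,
and has the structure of a smooth manifold of some finite dimension, compatible with the given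
topology, such that multiplication and inversion are smooth. -/
def IsCompactLieGroup (G : Type*) [Group G] [TopologicalSpace G] : Prop :=
  CompactSpace G ∧ T2Space G ∧ SecondCountableTopology G ∧
    ∃ (n : ℕ) (_ : ChartedSpace (EuclideanSpace ℝ (Fin n)) G), LieGroup (𝓡 n) ∞ G

/-! ### Universal sets of gates and transversal realisations -/

section Gates

/-- The operator on `d` qubits that acts as `u ∈ U(2)` on the qubit `j` and as the identity on
the others. -/
def oneQubitGate {d : ℕ} (j : Fin d) (u : U2) : UnitaryOn (Fin d) := tensorU (Pi.mulSingle j u)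

/-- The unitary scalars on `d` qubits. -/
def phases (d : ℕ) : Set (UnitaryOn (Fin d)) :=
  {U | ∃ c : ℂ, (U : Matrix (Fin d → Fin 2) (Fin d → Fin 2) ℂ) = c • 1}

/-- A set of gates on `d` qubits is universal for the qubit `j` if, up to phases, the group that
it generates contains arbitrarily good approximations of all one-qubit gates on `j`. -/
def IsUniversalOn {d : ℕ} (j : Fin d) (𝒢 : Set (UnitaryOn (Fin d))) : Prop :=
  ∀ u : U2, oneQubitGate j u ∈
    closure ((Subgroup.closure (𝒢 ∪ phases d) : Subgroup (UnitaryOn (Fin d))) :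
      Set (UnitaryOn (Fin d)))

variable {P : Type*} [Fintype P] [DecidableEq P] {L : Submodule (ZMod 2) (P → V)}

/-- Given an identification `φ` of the code with the space of `d` logical qubits, the logical
operator `W` allows approximate transversal realisations: for each `ε > 0` there is a local
unitary operator whose restriction to the code is, up to a phase, `ε`-close in operator norm to
the operator on the code that corresponds to `W`. The local unitary need not preserve the code,
and exact realisations are the special case of distance zero. -/
def IsApproxTransversal (σ : Sec L) {d : ℕ} (φ : code σ ≃ₗ[ℂ] StateSpace (Fin d))
    (W : UnitaryOn (Fin d)) : Prop :=
  ∀ ε : ℝ, 0 < ε → ∃ (u : P → U2) (c : ℂ), ‖c‖ = 1 ∧ ∀ ψ : code σ,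
    ‖act (tensorU u) (ψ : StateSpace P) - c • (φ.symm (act W (φ ψ)) : StateSpace P)‖ ≤ ε * ‖ψ‖

end Gates

end StabCode

end

/-!
Fix a qubit `p`. The coefficients, with respect to the Pauli operators, of the rotation that an
automorphism of the code performs at `p` satisfy a product formula along the stabilizers of minimal
support. It forces the automorphisms at `p` either to preserve an axis or to be integral rotations,
unless `p` lies in a subsystem on which `L` is Lagrangian, such as a pair of qubits in a Bell state.
On such a subsystem the code has a fixed state, so local unitary operators act there by scalars and
these qubits can be dropped. What remains of the automorphism group is a closed subgroup of a
product of solvable groups, and near the identity it consists of axis rotations. This gives the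
solvability and, because the angles of the axis rotations are local coordinates, the Lie structure.

By compactness, an operator with approximate transversal realisations has an exact one, and the
logical operators with exact transversal realisations form a closed group that is solvable modulo
phases. It does not contain all one-qubit gates, because `U(2)` is not solvable.
-/

noncomputable section

namespace StabCode

section LocallyAdditive

open Filter Topology

variable {E F : Type*} [NormedAddCommGroup E] [NormedSpace ℝ E]
  [NormedAddCommGroup F] [NormedSpace ℝ F] {χ : E → F} {δ : ℝ}

/-- Additivity of a map on the open ball of radius `δ` about `0`, required only where the sum lies
in the ball as well. -/
def IsAdditiveOnBall (χ : E → F) (δ : ℝ) : Prop :=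
  ∀ x y, ‖x‖ < δ → ‖y‖ < δ → ‖x + y‖ < δ → χ (x + y) = χ x + χ y

theorem IsAdditiveOnBall.map_two_pow_smul (h : IsAdditiveOnBall χ δ) {n : ℕ} {x : E}
    (hx : ‖(2 : ℝ) ^ n • x‖ < δ) : χ ((2 : ℝ) ^ n • x) = (2 : ℝ) ^ n • χ x := by
  induction n with
  | zero => simp
  | succ n ih =>
    have hdouble : (2 : ℝ) ^ (n + 1) • x = (2 : ℝ) ^ n • x + (2 : ℝ) ^ n • x := by
      rw [← two_smul ℝ, smul_smul, pow_succ']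
    have hhalf : ‖(2 : ℝ) ^ n • x‖ < δ := by
      refine lt_of_le_of_lt ?_ hx
      rw [norm_smul, norm_smul]
      gcongr
      simp only [norm_pow, Real.norm_ofNat]
      exact pow_le_pow_right₀ one_le_two n.le_succ
    rw [hdouble, h _ _ hhalf hhalf (hdouble ▸ hx), ih hhalf, pow_succ', mul_smul, two_smul]

theorem IsAdditiveOnBall.two_pow_smul_map_eq (h : IsAdditiveOnBall χ δ) {m n : ℕ} {x : E}
    (hm : ‖((2 : ℝ) ^ m)⁻¹ • x‖ < δ) (hn : ‖((2 : ℝ) ^ n)⁻¹ • x‖ < δ) :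
    (2 : ℝ) ^ m • χ (((2 : ℝ) ^ m)⁻¹ • x) = (2 : ℝ) ^ n • χ (((2 : ℝ) ^ n)⁻¹ • x) := by
  wlog hmn : m ≤ n generalizing m n
  · exact (this hn hm (le_of_not_ge hmn)).symm
  obtain ⟨k, rfl⟩ := Nat.exists_eq_add_of_le hmn
  have hscale : ((2 : ℝ) ^ m)⁻¹ • x = (2 : ℝ) ^ k • ((2 : ℝ) ^ (m + k))⁻¹ • x := by
    rw [smul_smul, pow_add]
    congr 1
    field_simp
  rw [hscale, h.map_two_pow_smul (hscale ▸ hm), smul_smul, ← pow_add]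

theorem eventually_norm_inv_two_pow_smul_lt (hδ : 0 < δ) (x : E) :
    ∀ᶠ n : ℕ in atTop, ‖((2 : ℝ) ^ n)⁻¹ • x‖ < δ := by
  have hlim : Tendsto (fun n : ℕ => ((2 : ℝ) ^ n)⁻¹ • x) atTop (𝓝 0) := by
    simpa using (tendsto_inv_atTop_zero.comp
      (tendsto_pow_atTop_atTop_of_one_lt (one_lt_two : (1 : ℝ) < 2))).smul_const x
  simpa using hlim.norm.eventually_lt_const (by simpa using hδ)

theorem IsAdditiveOnBall.exists_addMonoidHom (h : IsAdditiveOnBall χ δ) (hδ : 0 < δ) :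
    ∃ T : E →+ F, ∀ x, ‖x‖ < δ → χ x = T x := by
  choose N hN using fun x : E => (eventually_norm_inv_two_pow_smul_lt hδ x).exists
  let T : E → F := fun x => (2 : ℝ) ^ N x • χ (((2 : ℝ) ^ N x)⁻¹ • x)
  have hT {n : ℕ} {x : E} (hx : ‖((2 : ℝ) ^ n)⁻¹ • x‖ < δ) :
      T x = (2 : ℝ) ^ n • χ (((2 : ℝ) ^ n)⁻¹ • x) := h.two_pow_smul_map_eq (hN x) hx
  have hadd (x y : E) : T (x + y) = T x + T y := by
    obtain ⟨n, hx, hy, hxy⟩ := ((eventually_norm_inv_two_pow_smul_lt hδ x).and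
      ((eventually_norm_inv_two_pow_smul_lt hδ y).and
        (eventually_norm_inv_two_pow_smul_lt hδ (x + y)))).exists
    rw [hT hx, hT hy, hT hxy, smul_add, h _ _ hx hy (smul_add (_ : ℝ) x y ▸ hxy), smul_add]
  exact ⟨AddMonoidHom.mk' T hadd, fun x hx => by simpa using (hT (n := 0) (x := x) (by simpa)).symm⟩

theorem IsAdditiveOnBall.exists_continuousLinearMap (h : IsAdditiveOnBall χ δ) (hδ : 0 < δ)
    (hχ : ContinuousAt χ 0) : ∃ T : E →L[ℝ] F, ∀ x, ‖x‖ < δ → χ x = T x := by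
  obtain ⟨T, hT⟩ := h.exists_addMonoidHom hδ
  have hTχ : T =ᶠ[𝓝 0] χ := by
    filter_upwards [Metric.ball_mem_nhds (0 : E) hδ] with x hx
    exact (hT x (by simpa using hx)).symm
  exact ⟨T.toRealLinearMap (continuous_of_continuousAt_zero T (hχ.congr hTχ.symm)), hT⟩

end LocallyAdditive

section ClosedSubgroup

open Filter Topology

variable {E : Type*} [NormedAddCommGroup E] [NormedSpace ℝ E] {K : AddSubgroup E}

/-- The largest linear subspace contained in an additive subgroup of a real vector space. -/
def linearPart (K : AddSubgroup E) : Submodule ℝ E where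
  carrier := {x | ∀ t : ℝ, t • x ∈ K}
  add_mem' {x y} hx hy t := by rw [smul_add]; exact K.add_mem (hx t) (hy t)
  zero_mem' t := by rw [smul_zero]; exact K.zero_mem
  smul_mem' c x hx t := by rw [smul_smul]; exact hx _

theorem mem_of_mem_linearPart {x : E} (hx : x ∈ linearPart K) : x ∈ K := by
  simpa using hx 1

theorem tendsto_floor_div_mul (t : ℝ) :
    Tendsto (fun r : ℝ => ⌊t / r⌋ * r) (𝓝[>] 0) (𝓝 t) := by
  have hlower : Tendsto (fun r : ℝ => t - r) (𝓝[>] 0) (𝓝 t) :=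
    ((continuous_sub_left t).tendsto' 0 t (sub_zero t)).mono_left nhdsWithin_le_nhds
  refine tendsto_of_tendsto_of_tendsto_of_le_of_le' hlower tendsto_const_nhds ?_ ?_
  all_goals filter_upwards [self_mem_nhdsWithin] with r (hr : 0 < r)
  · have := (div_lt_iff₀ hr).mp (Int.lt_floor_add_one (t / r))
    linarith
  · exact (le_div_iff₀ hr).mp (Int.floor_le (t / r))

theorem mem_linearPart_of_tendsto (hK : IsClosed (K : Set E)) {z : ℕ → E} {y : E}
    (hzK : ∀ n, z n ∈ K) (hz0 : ∀ n, z n ≠ 0) (hz : Tendsto z atTop (𝓝 0))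
    (hy : Tendsto (fun n => ‖z n‖⁻¹ • z n) atTop (𝓝 y)) : y ∈ linearPart K := by
  intro t
  have hnorm : Tendsto (fun n => ‖z n‖) atTop (𝓝[>] 0) :=
    tendsto_nhdsWithin_iff.mpr ⟨by simpa using hz.norm,
      Eventually.of_forall fun n => norm_pos_iff.mpr (hz0 n)⟩
  refine hK.mem_of_tendsto (((tendsto_floor_div_mul t).comp hnorm).smul hy)
    (Eventually.of_forall fun n => ?_)
  have hmultiple : (⌊t / ‖z n‖⌋ * ‖z n‖) • ‖z n‖⁻¹ • z n = ⌊t / ‖z n‖⌋ • z n := by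
    rw [smul_smul, mul_assoc, mul_inv_cancel₀ (norm_ne_zero_iff.mpr (hz0 n)), mul_one,
      Int.cast_smul_eq_zsmul]
  exact hmultiple ▸ K.zsmul_mem (hzK n) _

theorem exists_forall_norm_lt_eq_zero_of_disjoint_linearPart [FiniteDimensional ℝ E]
    (hK : IsClosed (K : Set E)) {F : Submodule ℝ E} (hF : Disjoint (linearPart K) F) :
    ∃ r : ℝ, 0 < r ∧ ∀ x ∈ K, x ∈ F → ‖x‖ < r → x = 0 := by
  by_contra! hcon
  choose z hzK hzF hzlt hz0 using fun n : ℕ => hcon (1 / ((n : ℝ) + 1)) (by positivity)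
  have hz : Tendsto z atTop (𝓝 0) := squeeze_zero_norm (fun n => (hzlt n).le)
    tendsto_one_div_add_atTop_nhds_zero_nat
  have hunit (n : ℕ) : ‖z n‖⁻¹ • z n ∈ Metric.sphere (0 : E) 1 := by
    simpa using norm_smul_inv_norm (𝕜 := ℝ) (hz0 n)
  obtain ⟨y, hy, k, hk, hlim⟩ := (isCompact_sphere (0 : E) 1).tendsto_subseq hunit
  have hyF : y ∈ F := F.closed_of_finiteDimensional.mem_of_tendsto hlim
    (Eventually.of_forall fun n => F.smul_mem _ (hzF _))
  have hyK : y ∈ linearPart K := mem_linearPart_of_tendsto hK (fun n => hzK (k n))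
    (fun n => hz0 (k n)) (hz.comp hk.tendsto_atTop) hlim
  simp [Submodule.disjoint_def.mp hF y hyK hyF] at hy

theorem eventually_mem_linearPart [FiniteDimensional ℝ E] (hK : IsClosed (K : Set E)) :
    ∀ᶠ x in 𝓝 0, x ∈ K → x ∈ linearPart K := by
  obtain ⟨F, hF⟩ := (linearPart K).exists_isCompl
  obtain ⟨r, hr, hball⟩ := exists_forall_norm_lt_eq_zero_of_disjoint_linearPart hK hF.disjoint
  let q : E →ₗ[ℝ] E := F.projection (linearPart K) hF.symm
  have hq : ∀ᶠ x in 𝓝 0, ‖q x‖ < r :=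
    q.continuous_of_finiteDimensional.norm.continuousAt.eventually_lt_const (by simpa using hr)
  filter_upwards [hq] with x hx hxK
  have hsub : x - q x ∈ linearPart K := by
    rw [← Submodule.projection_apply_eq_zero_iff hF.symm, map_sub, sub_eq_zero]
    exact (Submodule.projection_apply_of_mem_left hF.symm
      (Submodule.projection_apply_mem hF.symm x)).symm
  have hqK : q x ∈ K := by simpa using K.sub_mem hxK (mem_of_mem_linearPart hsub)
  have hq0 : q x = 0 := hball _ hqK (Submodule.projection_apply_mem hF.symm x) hx
  simpa [hq0] using hsub

end ClosedSubgroup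

section LocalExp

open Filter Topology Multiplicative

/-- A continuous open homomorphism from the additive group of a normed space to a topological
group, together with a ball on which it is injective. Groups with such a homomorphism are Lie
groups whose identity component is abelian. -/
structure LocalExp (E G : Type*) [NormedAddCommGroup E] [Group G] [TopologicalSpace G] where
  hom : Multiplicative E →* G
  continuous_hom : Continuous hom
  isOpenMap_hom : IsOpenMap hom
  radius : ℝ
  radius_pos : 0 < radius
  injOn : Set.InjOn (fun x => hom (ofAdd x)) (Metric.ball 0 radius)

namespace LocalExp

variable {E G : Type*} [NormedAddCommGroup E] [Group G] [TopologicalSpace G]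

/-- The homomorphism as a function on the normed space, written additively. -/
def exp (e : LocalExp E G) (x : E) : G := e.hom (ofAdd x)

instance : CoeFun (LocalExp E G) fun _ => E → G := ⟨exp⟩

variable (e : LocalExp E G)

theorem map_zero : e 0 = 1 := map_one e.hom

theorem map_add (x y : E) : e (x + y) = e x * e y := map_mul e.hom (ofAdd x) (ofAdd y)

theorem map_neg (x : E) : e (-x) = (e x)⁻¹ := map_inv e.hom (ofAdd x)

theorem continuous : Continuous e := e.continuous_hom.comp continuous_ofAdd

theorem isOpenMap : IsOpenMap e :=
  e.isOpenMap_hom.comp (Homeomorph.refl E : E ≃ₜ Multiplicative E).isOpenMap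

/-- The local inverse of the exponential map. -/
def log : OpenPartialHomeomorph G E :=
  (OpenPartialHomeomorph.ofContinuousOpen e.injOn.toPartialEquiv
    e.continuous.continuousOn e.isOpenMap Metric.isOpen_ball).symm

theorem log_exp {x : E} (hx : ‖x‖ < e.radius) : e.log (e x) = x :=
  e.log.right_inv (mem_ball_zero_iff.mpr hx)

theorem exp_log {a : G} (ha : a ∈ e.log.source) : e (e.log a) = a := e.log.left_inv ha

theorem norm_log_lt {a : G} (ha : a ∈ e.log.source) : ‖e.log a‖ < e.radius :=
  mem_ball_zero_iff.mp (e.log.map_source ha)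

theorem one_mem_log_source : (1 : G) ∈ e.log.source :=
  ⟨0, Metric.mem_ball_self e.radius_pos, e.map_zero⟩

theorem log_one : e.log 1 = 0 := by
  rw [← e.map_zero, e.log_exp (by simpa using e.radius_pos)]

theorem eventually_norm_lt_radius {X : Type*} [TopologicalSpace X] {f : X → E} {x : X}
    (hf : ContinuousAt f x) (hx : ‖f x‖ < e.radius) : ∀ᶠ y in 𝓝 x, ‖f y‖ < e.radius :=
  hf.norm.eventually_lt_const hx

theorem log_mul {a b : G} (ha : a ∈ e.log.source) (hb : b ∈ e.log.source)
    (hab : ‖e.log a + e.log b‖ < e.radius) : e.log (a * b) = e.log a + e.log b := by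
  rw [← e.log_exp hab, e.map_add, e.exp_log ha, e.exp_log hb]

variable [IsTopologicalGroup G]

/-- The translate to `g` of the logarithmic chart. -/
def chart (g : G) : OpenPartialHomeomorph G E :=
  (Homeomorph.mulLeft g⁻¹).transOpenPartialHomeomorph e.log

theorem chart_apply (g a : G) : e.chart g a = e.log (g⁻¹ * a) := rfl

theorem mem_chart_source {g a : G} : a ∈ (e.chart g).source ↔ g⁻¹ * a ∈ e.log.source := Iff.rfl

theorem chart_symm_apply (g : G) (x : E) : (e.chart g).symm x = g * e x := by
  change g⁻¹⁻¹ * e x = _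
  rw [inv_inv]

theorem chart_self (g : G) : e.chart g g = 0 := by
  rw [chart_apply, inv_mul_cancel, e.log_one]

/-- The atlas of all translates of the logarithmic chart. -/
@[reducible] def chartedSpace : ChartedSpace E G where
  atlas := Set.range e.chart
  chartAt := e.chart
  mem_chart_source g := by rw [mem_chart_source, inv_mul_cancel]; exact e.one_mem_log_source
  chart_mem_atlas g := ⟨g, rfl⟩

theorem eventually_chart_chart_symm_eq {g h : G} {x₀ : E}
    (hx₀ : (e.chart g).symm x₀ ∈ (e.chart h).source) :
    ∀ᶠ x in 𝓝 x₀, e.chart h ((e.chart g).symm x) =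
      e.chart h ((e.chart g).symm x₀) + (x - x₀) := by
  rw [chart_symm_apply, mem_chart_source] at hx₀
  have hcont : ContinuousAt (fun x => e.log (h⁻¹ * (g * e x₀)) + (x - x₀)) x₀ := by fun_prop
  filter_upwards [e.eventually_norm_lt_radius hcont (by simpa using e.norm_log_lt hx₀)] with x hx
  simp only [chart_symm_apply, chart_apply]
  rw [← e.log_exp hx, e.map_add, e.exp_log hx₀, mul_assoc, mul_assoc, ← e.map_add, add_sub_cancel]

theorem eventually_log_conj_mem (h : G) :
    ∀ᶠ x in 𝓝 0, h⁻¹ * e x * h ∈ e.log.source ∧ ‖e.log (h⁻¹ * e x * h)‖ < e.radius / 2 := by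
  have hconj : Continuous fun x => h⁻¹ * e x * h := by have := e.continuous; fun_prop
  have hconj0 : h⁻¹ * e 0 * h = 1 := by simp [e.map_zero]
  have hnear : ∀ᶠ a in 𝓝 (1 : G), a ∈ e.log.source ∧ ‖e.log a‖ < e.radius / 2 :=
    (e.log.open_source.eventually_mem e.one_mem_log_source).and
      ((e.log.continuousAt e.one_mem_log_source).norm.eventually_lt_const
        (by simpa [e.log_one] using e.radius_pos))
  exact (hconj.tendsto' 0 1 hconj0).eventually hnear

variable [NormedSpace ℝ E]

theorem isManifold : @IsManifold ℝ _ E _ _ E _ 𝓘(ℝ, E) ∞ G _ e.chartedSpace := by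
  let _ := e.chartedSpace
  refine isManifold_of_contDiffOn _ _ _ ?_
  rintro _ _ ⟨g, rfl⟩ ⟨h, rfl⟩ x₀ ⟨⟨-, hx₀⟩, -⟩
  have hsmooth : ContDiffAt ℝ ∞
      (fun x : E => e.chart h ((e.chart g).symm x₀) + (x - x₀)) x₀ := by fun_prop
  exact (hsmooth.congr_of_eventuallyEq (e.eventually_chart_chart_symm_eq hx₀)).contDiffWithinAt

theorem exists_conj_eq (h : G) :
    ∃ T : E →L[ℝ] E, ∀ᶠ x in 𝓝 0, h⁻¹ * e x * h = e (T x) := by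
  let χ : E → E := fun x => e.log (h⁻¹ * e x * h)
  obtain ⟨δ, hδ, hball⟩ := Metric.eventually_nhds_iff.mp (e.eventually_log_conj_mem h)
  simp only [dist_zero_right] at hball
  have hadd : IsAdditiveOnBall χ δ := by
    intro x y hx hy _
    obtain ⟨hxs, hxr⟩ := hball hx
    obtain ⟨hys, hyr⟩ := hball hy
    have hxy : h⁻¹ * e (x + y) * h = h⁻¹ * e x * h * (h⁻¹ * e y * h) := by rw [e.map_add]; group
    change e.log (h⁻¹ * e (x + y) * h) = _
    rw [hxy, e.log_mul hxs hys ((norm_add_le _ _).trans_lt (by linarith))]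
  have hcont : ContinuousAt χ 0 := by
    have hconj : Continuous fun x => h⁻¹ * e x * h := by have := e.continuous; fun_prop
    exact ContinuousAt.comp (g := e.log)
      (e.log.continuousAt (hball (by simpa using hδ)).1) hconj.continuousAt
  obtain ⟨T, hT⟩ := hadd.exists_continuousLinearMap hδ hcont
  refine ⟨T, ?_⟩
  filter_upwards [Metric.ball_mem_nhds (0 : E) hδ] with x hx
  rw [mem_ball_zero_iff] at hx
  rw [← hT x hx, e.exp_log (hball hx).1]

theorem exists_eventually_chart_mul_eq (g h : G) : ∃ T : E →L[ℝ] E, ∀ᶠ z : E × E in 𝓝 0,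
    e.chart (g * h) ((e.chart g).symm z.1 * (e.chart h).symm z.2) = T z.1 + z.2 := by
  obtain ⟨T, hT⟩ := e.exists_conj_eq h
  have hcont : ContinuousAt (fun z : E × E => T z.1 + z.2) 0 := by fun_prop
  refine ⟨T, ?_⟩
  filter_upwards [(continuous_fst.tendsto' (0 : E × E) 0 rfl).eventually hT,
    e.eventually_norm_lt_radius hcont (by simpa using e.radius_pos)] with z hconj hz
  rw [← e.log_exp hz, e.map_add, ← hconj, chart_symm_apply, chart_symm_apply, chart_apply]
  congr 1
  group

theorem exists_eventually_chart_inv_eq (g : G) : ∃ T : E →L[ℝ] E, ∀ᶠ x in 𝓝 0,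
    e.chart g⁻¹ ((e.chart g).symm x)⁻¹ = T x := by
  obtain ⟨T, hT⟩ := e.exists_conj_eq g⁻¹
  refine ⟨-T, ?_⟩
  filter_upwards [hT, e.eventually_norm_lt_radius (-T).continuous.continuousAt
    (by simpa using e.radius_pos)] with x hconj hx
  rw [← e.log_exp hx, neg_apply, e.map_neg, ← hconj, chart_symm_apply,
    chart_apply]
  congr 1
  group

theorem lieGroup : @LieGroup ℝ _ E _ E _ _ 𝓘(ℝ, E) ∞ G _ _ e.chartedSpace := by
  let _ := e.chartedSpace
  have := e.isManifold
  have hchartAt (g : G) : chartAt E g = e.chart g := rfl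
  refine { contMDiff_mul := ?_, contMDiff_inv := ?_ }
  · rintro ⟨g, h⟩
    obtain ⟨T, hT⟩ := e.exists_eventually_chart_mul_eq g h
    have hsmooth : ContDiffAt ℝ ∞ (fun z : E × E => T z.1 + z.2) 0 := by fun_prop
    have hbase : (extChartAt (𝓘(ℝ, E).prod 𝓘(ℝ, E)) (g, h)) (g, h) = (0 : E × E) := by
      simp [extChartAt, hchartAt, chart_self, OpenPartialHomeomorph.extend]
    rw [contMDiffAt_iff, hbase]
    exact ⟨continuous_mul.continuousAt, (hsmooth.congr_of_eventuallyEq hT).contDiffWithinAt⟩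
  · intro g
    obtain ⟨T, hT⟩ := e.exists_eventually_chart_inv_eq g
    have hsmooth : ContDiffAt ℝ ∞ T 0 := T.contDiff.contDiffAt
    have hbase : (extChartAt 𝓘(ℝ, E) g) g = (0 : E) := by
      simp [extChartAt, hchartAt, chart_self, OpenPartialHomeomorph.extend]
    rw [contMDiffAt_iff, hbase]
    exact ⟨continuous_inv.continuousAt, (hsmooth.congr_of_eventuallyEq hT).contDiffWithinAt⟩

end LocalExp

variable {E G : Type*} [NormedAddCommGroup E] [NormedSpace ℝ E] [FiniteDimensional ℝ E]
  [Group G] [TopologicalSpace G] {f : Multiplicative E →* G}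

theorem isOpenMap_comp_of_isCompl {F : Type*} [NormedAddCommGroup F] [NormedSpace ℝ F]
    (hopen : IsOpenMap f) {i : F →ₗ[ℝ] E} (hi : Function.Injective i)
    (hcompl : IsCompl (linearPart f.ker.toAddSubgroup') (LinearMap.range i)) :
    IsOpenMap fun x => f (ofAdd (i x)) := by
  let q : E →ₗ[ℝ] F := (LinearEquiv.ofInjective i hi).symm ∘ₗ
    (LinearMap.range i).projectionOnto (linearPart f.ker.toAddSubgroup') hcompl.symm
  have hqi (x : F) : q (i x) = x := (LinearEquiv.symm_apply_eq _).mpr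
    (Submodule.projectionOnto_apply_left hcompl.symm (LinearEquiv.ofInjective i hi x))
  have hker (x : E) : x - i (q x) ∈ linearPart f.ker.toAddSubgroup' := by
    rw [← Submodule.projectionOnto_apply_eq_zero_iff hcompl.symm]
    apply (LinearEquiv.ofInjective i hi).symm.injective
    change q (x - i (q x)) = _
    rw [map_sub, hqi, sub_self, map_zero]
  have hfq (x : E) : f (ofAdd (i (q x))) = f (ofAdd x) := by
    have : f (ofAdd (x - i (q x))) = 1 := mem_of_mem_linearPart (hker x)
    rwa [ofAdd_sub, map_div, div_eq_one, eq_comm] at this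
  intro U hU
  have himage : (fun x => f (ofAdd (i x))) '' U = f '' (toAdd ⁻¹' (q ⁻¹' U)) := by
    ext a
    constructor
    · rintro ⟨x, hx, rfl⟩
      exact ⟨ofAdd (i x), by simpa [hqi] using hx, rfl⟩
    · rintro ⟨x, hx, rfl⟩
      exact ⟨q (toAdd x), hx, hfq (toAdd x)⟩
  rw [himage]
  exact hopen _ ((hU.preimage q.continuous_of_finiteDimensional).preimage continuous_toAdd)

theorem exists_injOn_ball_of_isCompl [T2Space G] {F : Type*} [NormedAddCommGroup F]
    [NormedSpace ℝ F] (hcont : Continuous f) {i : F →L[ℝ] E} (hi : Function.Injective i)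
    (hcompl : IsCompl (linearPart f.ker.toAddSubgroup') (LinearMap.range (i : F →ₗ[ℝ] E))) :
    ∃ ρ : ℝ, 0 < ρ ∧ Set.InjOn (fun x => f (ofAdd (i x))) (Metric.ball 0 ρ) := by
  have hclosed : IsClosed (f.ker.toAddSubgroup' : Set E) :=
    isClosed_singleton.preimage (hcont.comp continuous_ofAdd)
  obtain ⟨r, hr, hball⟩ :=
    exists_forall_norm_lt_eq_zero_of_disjoint_linearPart hclosed hcompl.disjoint
  have hsmall : ∀ᶠ x in 𝓝 0, ‖i x‖ < r / 2 :=
    i.continuous.continuousAt.norm.eventually_lt_const (by simpa using hr)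
  obtain ⟨ρ, hρ, hρr⟩ := Metric.eventually_nhds_iff.mp hsmall
  refine ⟨ρ, hρ, fun x hx y hy hxy => hi (sub_eq_zero.mp (hball _ ?_ ?_ ?_))⟩
  · change f (ofAdd (i x - i y)) = 1
    rw [ofAdd_sub, map_div, div_eq_one]
    exact hxy
  · exact Submodule.sub_mem _ ⟨x, rfl⟩ ⟨y, rfl⟩
  · linarith [norm_sub_le (i x) (i y), hρr hx, hρr hy]

theorem exists_lieGroup_of_isOpenMap [IsTopologicalGroup G] [T2Space G] (hcont : Continuous f)
    (hopen : IsOpenMap f) :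
    ∃ (n : ℕ) (_ : ChartedSpace (EuclideanSpace ℝ (Fin n)) G), LieGroup (𝓡 n) ∞ G := by
  obtain ⟨F, hF⟩ := (linearPart f.ker.toAddSubgroup').exists_isCompl
  let ι : EuclideanSpace ℝ (Fin (Module.finrank ℝ F)) ≃L[ℝ] F :=
    ContinuousLinearEquiv.ofFinrankEq (by simp)
  let i : EuclideanSpace ℝ (Fin (Module.finrank ℝ F)) →L[ℝ] E := F.subtypeL ∘L ι
  have hi : Function.Injective i := F.injective_subtype.comp ι.injective
  have hcompl : IsCompl (linearPart f.ker.toAddSubgroup')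
      (LinearMap.range (i : EuclideanSpace ℝ (Fin (Module.finrank ℝ F)) →ₗ[ℝ] E)) := by
    have hrange : LinearMap.range (i : EuclideanSpace ℝ (Fin (Module.finrank ℝ F)) →ₗ[ℝ] E) = F :=
      (LinearEquiv.range_comp ι.toLinearEquiv F.subtype).trans F.range_subtype
    rwa [hrange]
  obtain ⟨ρ, hρ, hinj⟩ := exists_injOn_ball_of_isCompl hcont hi hcompl
  let e : LocalExp (EuclideanSpace ℝ (Fin (Module.finrank ℝ F))) G :=
    { hom := f.comp (AddMonoidHom.toMultiplicative (i : _ →+ E))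
      continuous_hom := hcont.comp (continuous_ofAdd.comp (i.continuous.comp continuous_toAdd))
      isOpenMap_hom := (isOpenMap_comp_of_isCompl hopen hi hcompl).comp
        (Homeomorph.refl _ : Multiplicative _ ≃ₜ _).isOpenMap
      radius := ρ
      radius_pos := hρ
      injOn := hinj }
  exact ⟨_, e.chartedSpace, e.lieGroup⟩

theorem exists_lieGroup_of_eventually_mem_image [IsTopologicalGroup G] [T2Space G] {M : Type*}
    [Group M] [TopologicalSpace M] {A : Subgroup M} (hA : IsClosed (A : Set M)) {π : A →* G}
    (hπ : Continuous π) {ρ : Multiplicative E →* M} (hρ : Continuous ρ)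
    (h : ∀ ε > 0, ∀ᶠ g in 𝓝 1, ∃ (x : E) (hx : ρ (ofAdd x) ∈ A), ‖x‖ < ε ∧ π ⟨_, hx⟩ = g) :
    ∃ (n : ℕ) (_ : ChartedSpace (EuclideanSpace ℝ (Fin n)) G), LieGroup (𝓡 n) ∞ G := by
  let K : AddSubgroup E := (A.comap ρ).toAddSubgroup'
  obtain ⟨r, hr, hball⟩ := Metric.eventually_nhds_iff.mp
    (eventually_mem_linearPart (K := K) (hA.preimage (hρ.comp continuous_ofAdd)))
  let ι : Multiplicative (linearPart K) →* M :=
    ρ.comp (AddMonoidHom.toMultiplicative (linearPart K).subtype.toAddMonoidHom)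
  have hι (x : Multiplicative (linearPart K)) : ι x ∈ A := mem_of_mem_linearPart (toAdd x).2
  have hcont : Continuous ι :=
    hρ.comp (continuous_ofAdd.comp (continuous_subtype_val.comp continuous_toAdd))
  refine exists_lieGroup_of_isOpenMap (f := π.comp (ι.codRestrict A hι))
    (hπ.comp (hcont.subtype_mk hι)) (IsTopologicalGroup.isOpenMap_iff_nhds_one.mpr ?_)
  intro U hU
  obtain ⟨ε, hε, hεU⟩ := Metric.mem_nhds_iff.mp
    (continuous_ofAdd.continuousAt.preimage_mem_nhds (x := (0 : linearPart K)) (mem_map.mp hU))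
  filter_upwards [h (min ε r) (lt_min hε hr)] with g hg
  obtain ⟨x, hxA, hx, rfl⟩ := hg
  have hxK : x ∈ linearPart K := hball (by simpa using hx.trans_le (min_le_right _ _)) hxA
  have hxε : (⟨x, hxK⟩ : linearPart K) ∈ Metric.ball 0 ε := by
    simpa using hx.trans_le (min_le_left _ _)
  exact hεU hxε

end LocalExp

section SpecialUnitary

variable {n 𝕜 : Type*} [Fintype n] [DecidableEq n] [RCLike 𝕜]

theorem isCompact_of_isClosed_of_subset_unitaryGroup {S : Set (Matrix n n 𝕜)} (hS : IsClosed S)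
    (hsub : S ⊆ Matrix.unitaryGroup n 𝕜) : IsCompact S := by
  have hbox : IsCompact (Set.univ.pi fun _ : n => Set.univ.pi fun _ : n =>
      Metric.closedBall (0 : 𝕜) 1) :=
    isCompact_univ_pi fun _ => isCompact_univ_pi fun _ => isCompact_closedBall 0 1
  exact hbox.of_isClosed_subset hS fun U hU a _ b _ => by
    simpa using entry_norm_bound_of_unitary (hsub hU) a b

instance compactSpace_unitaryGroup : CompactSpace (Matrix.unitaryGroup n 𝕜) :=
  isCompact_iff_compactSpace.mp <| isCompact_of_isClosed_of_subset_unitaryGroup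
    (isClosed_unitary : IsClosed (unitary (Matrix n n 𝕜) : Set (Matrix n n 𝕜))) subset_rfl

instance compactSpace_specialUnitaryGroup : CompactSpace (Matrix.specialUnitaryGroup n 𝕜) :=
  isCompact_iff_compactSpace.mp <| isCompact_of_isClosed_of_subset_unitaryGroup
    ((isClosed_unitary : IsClosed (unitary (Matrix n n 𝕜) : Set (Matrix n n 𝕜))).inter
      (isClosed_eq (by fun_prop) continuous_const : IsClosed {M : Matrix n n 𝕜 | M.det = 1}))
    Matrix.specialUnitaryGroup_le_unitaryGroup

instance isTopologicalGroup_specialUnitaryGroup :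
    IsTopologicalGroup (Matrix.specialUnitaryGroup n 𝕜) where
  continuous_inv := (continuous_star.comp continuous_subtype_val).subtype_mk _

instance secondCountableTopology_specialUnitaryGroup :
    SecondCountableTopology (Matrix.specialUnitaryGroup n 𝕜) :=
  have : SecondCountableTopology (Matrix n n 𝕜) :=
    inferInstanceAs (SecondCountableTopology (n → n → 𝕜))
  Topology.IsEmbedding.subtypeVal.secondCountableTopology

end SpecialUnitary

section SpecialOrthogonal

open Matrix Topology Filter

variable {n : Type*} [Fintype n] [DecidableEq n]

theorem mem_specialOrthogonalGroup_iff_mul_transpose {M : Matrix n n ℝ} :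
    M ∈ specialOrthogonalGroup n ℝ ↔ M * Mᵀ = 1 ∧ M.det = 1 := by
  rw [mem_specialUnitaryGroup_iff, mem_unitaryGroup_iff, star_eq_conjTranspose,
    conjTranspose_eq_transpose_of_trivial]

theorem coe_mul_transpose_coe (g : specialOrthogonalGroup n ℝ) : g.1 * g.1ᵀ = 1 :=
  (mem_specialOrthogonalGroup_iff_mul_transpose.mp g.2).1

theorem det_coe (g : specialOrthogonalGroup n ℝ) : g.1.det = 1 :=
  (mem_specialOrthogonalGroup_iff_mul_transpose.mp g.2).2

theorem coe_inv (g : specialOrthogonalGroup n ℝ) : (g⁻¹).1 = g.1ᵀ := by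
  rw [← conjTranspose_eq_transpose_of_trivial]
  rfl

theorem adjugate_coe (g : specialOrthogonalGroup n ℝ) : g.1.adjugate = g.1ᵀ := by
  have h := congrArg (· * g.1ᵀ) g.1.adjugate_mul
  simpa only [Matrix.mul_assoc, coe_mul_transpose_coe, mul_one, det_coe, one_smul, one_mul] using h

theorem row_dotProduct_row (g : specialOrthogonalGroup n ℝ) (a b : n) :
    ∑ k, g.1 a k * g.1 b k = if a = b then 1 else 0 := by
  simpa [Matrix.mul_apply, Matrix.one_apply] using congr($(coe_mul_transpose_coe g) a b)

theorem col_dotProduct_col (g : specialOrthogonalGroup n ℝ) (a b : n) :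
    ∑ k, g.1 k a * g.1 k b = if a = b then 1 else 0 := by
  simpa only [coe_inv, transpose_apply] using row_dotProduct_row g⁻¹ a b

theorem continuous_entry (i j : n) : Continuous fun g : specialOrthogonalGroup n ℝ => g.1 i j :=
  continuous_subtype_val.matrix_elem i j

/-- The stabilizer of the `i`-th coordinate axis in the rotation group. -/
def axisStab (i : n) : Subgroup (specialOrthogonalGroup n ℝ) where
  carrier := {g | ∀ j, j ≠ i → g.1 i j = 0}
  one_mem' _ hj := Matrix.one_apply_ne hj.symm
  mul_mem' {g h} hg hh j hj := by
    rw [Submonoid.coe_mul, Matrix.mul_apply]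
    refine Finset.sum_eq_zero fun k _ => ?_
    obtain rfl | hk := eq_or_ne k i
    · rw [hh j hj, mul_zero]
    · rw [hg k hk, zero_mul]
  inv_mem' {g} hg j hj := by
    have hunit : IsUnit (g.1 i i) := IsUnit.of_mul_eq_one (g.1 i i) <| by
      simpa using (Finset.sum_eq_single i (fun k _ hk => by rw [hg k hk, zero_mul])
        (by simp)).symm.trans (row_dotProduct_row g i i)
    have horth : g.1 i i * g.1 j i = 0 := by
      simpa [hj.symm] using (Finset.sum_eq_single i (fun k _ hk => by rw [hg k hk, zero_mul])
        (by simp)).symm.trans (row_dotProduct_row g i j)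
    rw [coe_inv, transpose_apply]
    exact hunit.mul_right_eq_zero.mp horth

theorem apply_eq_zero_of_mem_axisStab {i j : n} {g : specialOrthogonalGroup n ℝ}
    (hg : g ∈ axisStab i) (hj : j ≠ i) : g.1 j i = 0 := by
  simpa only [coe_inv, transpose_apply] using (axisStab i).inv_mem hg j hj

theorem mul_apply_diag_of_mem_axisStab {i : n} {g : specialOrthogonalGroup n ℝ}
    (hg : g ∈ axisStab i) (h : specialOrthogonalGroup n ℝ) :
    (g * h).1 i i = g.1 i i * h.1 i i := by
  rw [Submonoid.coe_mul, Matrix.mul_apply]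
  exact Finset.sum_eq_single i (fun k _ hk => by rw [hg k hk, zero_mul]) (by simp)

/-- The sign with which an element of `axisStab i` acts on the `i`-th axis, as a real unit. -/
def axisSign (i : n) : axisStab i →* ℝˣ :=
  MonoidHom.toHomUnits
    { toFun := fun g => g.1.1 i i
      map_one' := Matrix.one_apply_eq i
      map_mul' := fun g h => mul_apply_diag_of_mem_axisStab g.2 h }

theorem sq_diag_of_mem_axisStab {i : n} {g : specialOrthogonalGroup n ℝ} (hg : g ∈ axisStab i) :
    g.1 i i ^ 2 = 1 := by
  have h := mul_apply_diag_of_mem_axisStab hg g⁻¹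
  rw [mul_inv_cancel, coe_inv, transpose_apply, ← sq] at h
  exact h.symm.trans (Matrix.one_apply_eq i)

/-- The rotations with integral matrix entries. -/
def integralRotations (n : Type*) [Fintype n] [DecidableEq n] :
    Subgroup (specialOrthogonalGroup n ℝ) where
  carrier := {g | ∀ i j, ∃ m : ℤ, g.1 i j = m}
  one_mem' i j := ⟨(1 : Matrix n n ℤ) i j, by simp [Matrix.one_apply]⟩
  mul_mem' {g h} hg hh i j := by
    choose a ha using hg
    choose b hb using hh
    refine ⟨∑ k, a i k * b k j, ?_⟩
    simp only [Submonoid.coe_mul, Matrix.mul_apply, ha, hb, Int.cast_sum, Int.cast_mul]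
  inv_mem' {g} hg i j := by
    rw [coe_inv, transpose_apply]
    exact hg j i

theorem eq_zero_of_sum_mul_self_eq_one {ι : Type*} [Fintype ι] {a : ι → ℤ}
    (h : ∑ k, a k * a k = 1) {i j : ι} (hij : i ≠ j) (hi : a i ≠ 0) : a j = 0 := by
  classical
  by_contra hj
  have hle : ∑ k ∈ {i, j}, a k * a k ≤ ∑ k, a k * a k :=
    Finset.sum_le_sum_of_subset_of_nonneg (Finset.subset_univ _) fun _ _ _ => mul_self_nonneg _
  rw [h, Finset.sum_pair hij] at hle
  have := mul_self_pos.mpr hi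
  have := mul_self_pos.mpr hj
  omega

theorem existsUnique_ne_zero_of_mem_integralRotations {g : specialOrthogonalGroup n ℝ}
    (hg : g ∈ integralRotations n) (j : n) : ∃! i, g.1 i j ≠ 0 := by
  choose a ha using hg
  have hsum : ∑ k, a k j * a k j = 1 := by
    have := col_dotProduct_col g j j
    simp only [ha, if_pos] at this
    exact_mod_cast this
  obtain ⟨i, -, hi⟩ := Finset.exists_ne_zero_of_sum_ne_zero (hsum ▸ one_ne_zero)
  have hi : a i j ≠ 0 := left_ne_zero_of_mul hi
  refine ⟨i, by simpa [ha] using hi, fun k hk => ?_⟩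
  by_contra hki
  exact hk (by simp [ha, eq_zero_of_sum_mul_self_eq_one hsum (Ne.symm hki) hi])

/-- The permutation of the coordinate axes that an integral rotation induces. -/
def axisPerm : integralRotations n →* Equiv.Perm n :=
  have hex (g : integralRotations n) := existsUnique_ne_zero_of_mem_integralRotations g.2
  MonoidHom.toHomPerm
    { toFun := fun g j => (hex g j).choose
      map_one' := funext fun j => ((hex 1 j).choose_spec.2 j (by simp)).symm
      map_mul' := fun g h => funext fun j => ((hex (g * h) j).choose_spec.2 _ <| by
        change (g.1.1 * h.1.1) _ j ≠ 0
        rw [Matrix.mul_apply, Finset.sum_eq_single (hex h j).choose (fun k _ hk => ?_) (by simp)]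
        · exact mul_ne_zero (hex g _).choose_spec.1 (hex h j).choose_spec.1
        · rw [not_not.mp (mt ((hex h j).choose_spec.2 k) hk), mul_zero]).symm }

theorem axisPerm_apply_eq_of_ne_zero {g : integralRotations n} {i j : n} (h : g.1.1 i j ≠ 0) :
    axisPerm g j = i :=
  ((existsUnique_ne_zero_of_mem_integralRotations g.2 j).choose_spec.2 i h).symm

theorem diagonal_eq_of_mem_ker_axisPerm {g : integralRotations n} (hg : g ∈ axisPerm.ker) :
    diagonal (fun i => g.1.1 i i) = g.1.1 := by
  refine IsDiag.diagonal_diag fun i j hij => ?_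
  by_contra h
  refine hij ?_
  rw [← axisPerm_apply_eq_of_ne_zero h, MonoidHom.mem_ker.mp hg, Equiv.Perm.one_apply]

instance isSolvable_integralRotations [Group.IsSolvable (Equiv.Perm n)] :
    Group.IsSolvable (integralRotations n) := by
  have hcomm (a b : (axisPerm (n := n)).ker) : a * b = b * a := by
    refine Subtype.ext <| Subtype.ext <| Subtype.ext ?_
    change a.1.1.1 * b.1.1.1 = b.1.1.1 * a.1.1.1
    rw [← diagonal_eq_of_mem_ker_axisPerm a.2, ← diagonal_eq_of_mem_ker_axisPerm b.2,
      diagonal_mul_diagonal, diagonal_mul_diagonal]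
    simp only [mul_comm]
  have : Group.IsSolvable (axisPerm (n := n)).ker := Group.isSolvable_of_comm hcomm
  exact Group.isSolvable_of_ker_le_range (axisPerm (n := n)).ker.subtype axisPerm (by simp)

theorem eventually_eq_one_of_mem_integralRotations :
    ∀ᶠ g : specialOrthogonalGroup n ℝ in 𝓝 1, g ∈ integralRotations n → g = 1 := by
  have hentry (i j : n) : ∀ᶠ g : specialOrthogonalGroup n ℝ in 𝓝 1,
      |g.1 i j - (1 : Matrix n n ℝ) i j| < 1 :=
    ((continuous_entry i j).sub continuous_const).abs.continuousAt.eventually_lt_const (by simp)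
  filter_upwards [eventually_all.mpr fun i => eventually_all.mpr (hentry i)] with g hg hintegral
  refine Subtype.ext <| Matrix.ext fun i j => ?_
  obtain ⟨k, hk⟩ := hintegral i j
  obtain ⟨m, hm : (1 : Matrix n n ℝ) i j = m⟩ := (integralRotations n).one_mem i j
  have hlt := hg i j
  rw [hk, hm] at hlt
  have hkm : k = m := sub_eq_zero.mp (Int.abs_lt_one_iff.mp (by exact_mod_cast hlt))
  rw [hk, hkm]
  exact hm.symm

instance isSolvable_perm_fin_three : Group.IsSolvable (Equiv.Perm (Fin 3)) := by
  have hcomm : ∀ a b : Equiv.Perm (Fin 3), Equiv.Perm.sign a = 1 → Equiv.Perm.sign b = 1 →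
      a * b = b * a := by decide
  have : Group.IsSolvable (Equiv.Perm.sign (α := Fin 3)).ker :=
    Group.isSolvable_of_comm fun a b => Subtype.ext (hcomm a.1 b.1 a.2 b.2)
  exact Group.isSolvable_of_ker_le_range (Equiv.Perm.sign (α := Fin 3)).ker.subtype
    Equiv.Perm.sign (by simp)

end SpecialOrthogonal

section CoordinateRotations

open Matrix Topology

/-- The matrix that fixes the `i`-th coordinate and acts as `!![c, -s; s, c]` on the two others,
taken in cyclic order. -/
def rotMat (i : Fin 3) (c s : ℝ) : Matrix (Fin 3) (Fin 3) ℝ := fun a b =>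
  if a = i then (if b = i then 1 else 0) else if b = i then 0 else
    if a = b then c else if a = i + 1 then -s else s

theorem rotMat_mul (i : Fin 3) (c s c' s' : ℝ) :
    rotMat i c s * rotMat i c' s' = rotMat i (c * c' - s * s') (s * c' + c * s') := by
  ext a b
  rw [Matrix.mul_apply, Fin.sum_univ_three]
  fin_cases i <;> fin_cases a <;> fin_cases b <;> simp [rotMat] <;> ring

theorem rotMat_transpose (i : Fin 3) (c s : ℝ) : (rotMat i c s)ᵀ = rotMat i c (-s) := by
  ext a b
  fin_cases i <;> fin_cases a <;> fin_cases b <;> simp [rotMat]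

theorem rotMat_one_zero (i : Fin 3) : rotMat i 1 0 = 1 := by
  ext a b
  fin_cases i <;> fin_cases a <;> fin_cases b <;> simp [rotMat]

theorem det_rotMat (i : Fin 3) (c s : ℝ) : (rotMat i c s).det = c ^ 2 + s ^ 2 := by
  rw [det_fin_three]
  fin_cases i <;> simp [rotMat] <;> ring

/-- The rotation by the angle `θ` about the `i`-th coordinate axis. -/
def rot (i : Fin 3) (θ : ℝ) : SO3 :=
  ⟨rotMat i (Real.cos θ) (Real.sin θ), mem_specialOrthogonalGroup_iff_mul_transpose.mpr
    ⟨by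
      rw [rotMat_transpose, rotMat_mul, ← rotMat_one_zero i]
      congr 1
      · linear_combination Real.sin_sq_add_cos_sq θ
      · ring,
    by rw [det_rotMat, Real.cos_sq_add_sin_sq]⟩⟩

theorem rot_add (i : Fin 3) (θ η : ℝ) : rot i (θ + η) = rot i θ * rot i η := by
  refine Subtype.ext ?_
  change rotMat _ _ _ = rotMat _ _ _ * rotMat _ _ _
  rw [rotMat_mul, Real.cos_add, Real.sin_add]

theorem rot_zero (i : Fin 3) : rot i 0 = 1 := by
  refine Subtype.ext ?_
  change rotMat _ _ _ = 1
  rw [Real.cos_zero, Real.sin_zero, rotMat_one_zero]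

theorem continuous_rot (i : Fin 3) : Continuous (rot i) := by
  refine Continuous.subtype_mk (continuous_matrix fun a b => ?_) _
  unfold rotMat
  split_ifs <;> fun_prop

theorem apply_eq_cofactor (g : SO3) (i j : Fin 3) :
    g.1 i j = g.1 (i + 1) (j + 1) * g.1 (i + 2) (j + 2) -
      g.1 (i + 1) (j + 2) * g.1 (i + 2) (j + 1) := by
  have h := congr($(adjugate_coe g) j i)
  rw [adjugate_fin_three] at h
  fin_cases i <;> fin_cases j <;> simp at h ⊢ <;> linear_combination -h

theorem eq_rotMat_of_mem_axisStab {i : Fin 3} {g : SO3} (hg : g ∈ axisStab i)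
    (hii : g.1 i i = 1) : g.1 = rotMat i (g.1 (i + 1) (i + 1)) (g.1 (i + 2) (i + 1)) := by
  have hne : i + 1 ≠ i ∧ i + 2 ≠ i := by clear * -; decide +revert
  have hrow₁ : g.1 i (i + 1) = 0 := hg _ hne.1
  have hrow₂ : g.1 i (i + 2) = 0 := hg _ hne.2
  have hcol₁ : g.1 (i + 1) i = 0 := apply_eq_zero_of_mem_axisStab hg hne.1
  have hcol₂ : g.1 (i + 2) i = 0 := apply_eq_zero_of_mem_axisStab hg hne.2
  have hdiag := apply_eq_cofactor g (i + 1) (i + 1)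
  have hoff := apply_eq_cofactor g (i + 1) (i + 2)
  ext a b
  fin_cases i <;> simp at hii hrow₁ hrow₂ hcol₁ hcol₂ hdiag hoff <;> fin_cases a <;>
    fin_cases b <;> simp [rotMat, hii, hrow₁, hrow₂, hcol₁, hcol₂, hdiag, hoff]

theorem sq_add_sq_eq_one_of_mem_axisStab {i : Fin 3} {g : SO3} (hg : g ∈ axisStab i)
    (hii : g.1 i i = 1) : g.1 (i + 1) (i + 1) ^ 2 + g.1 (i + 2) (i + 1) ^ 2 = 1 := by
  rw [← det_rotMat i, ← eq_rotMat_of_mem_axisStab hg hii, det_coe]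

instance isSolvable_axisStab (i : Fin 3) : Group.IsSolvable (axisStab i) := by
  have hcomm (a b : (axisSign i).ker) : a * b = b * a := by
    have hone (g : (axisSign i).ker) : g.1.1.1 i i = 1 := congrArg Units.val g.2
    refine Subtype.ext <| Subtype.ext <| Subtype.ext ?_
    change a.1.1.1 * b.1.1.1 = b.1.1.1 * a.1.1.1
    rw [eq_rotMat_of_mem_axisStab a.1.2 (hone a), eq_rotMat_of_mem_axisStab b.1.2 (hone b),
      rotMat_mul, rotMat_mul]
    congr 1 <;> ring
  have : Group.IsSolvable (axisSign i).ker := Group.isSolvable_of_comm hcomm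
  exact Group.isSolvable_of_ker_le_range (axisSign i).ker.subtype (axisSign i) (by simp)

theorem exists_eq_rot_of_mem_axisStab {i : Fin 3} {g : SO3} (hg : g ∈ axisStab i)
    (hii : 0 < g.1 i i) (hpos : 0 < g.1 (i + 1) (i + 1)) :
    g = rot i (Real.arcsin (g.1 (i + 2) (i + 1))) := by
  have hone : g.1 i i = 1 := by nlinarith [sq_diag_of_mem_axisStab hg]
  have hsq := sq_add_sq_eq_one_of_mem_axisStab hg hone
  refine Subtype.ext ((eq_rotMat_of_mem_axisStab hg hone).trans ?_)
  change _ = rotMat _ _ _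
  rw [Real.cos_arcsin, Real.sin_arcsin (by nlinarith) (by nlinarith), ← hsq,
    add_sub_cancel_right, Real.sqrt_sq hpos.le]

theorem eventually_eq_rot_of_mem_axisStab (i : Fin 3) {ε : ℝ} (hε : 0 < ε) :
    ∀ᶠ g : SO3 in 𝓝 1, g ∈ axisStab i → ∃ θ : ℝ, |θ| < ε ∧ g = rot i θ := by
  have hdiag (k : Fin 3) : ∀ᶠ g : SO3 in 𝓝 1, 0 < g.1 k k :=
    (continuous_entry k k).continuousAt.eventually_const_lt (by simp)
  have hoff : (1 : SO3).1 (i + 2) (i + 1) = 0 := Matrix.one_apply_ne (by fin_cases i <;> decide)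
  have hangle : ∀ᶠ g : SO3 in 𝓝 1, |Real.arcsin (g.1 (i + 2) (i + 1))| < ε :=
    (Real.continuous_arcsin.comp (continuous_entry _ _)).abs.continuousAt.eventually_lt_const
      (by simpa [hoff] using hε)
  filter_upwards [hdiag i, hdiag (i + 1), hangle] with g hii hpos hsmall hg
  exact ⟨_, hsmall, exists_eq_rot_of_mem_axisStab hg hii hpos⟩

end CoordinateRotations

section AdjointAction

variable {n : Type*} [Fintype n] [DecidableEq n]

/-- The adjoint action of the unitary group on matrices, `Ad U X = U X U⁻¹`. -/
abbrev Ad : Matrix.unitaryGroup n ℂ →* (Matrix n n ℂ ≃⋆ₐ[ℂ] Matrix n n ℂ) :=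
  Unitary.conjStarAlgAut ℂ (Matrix n n ℂ)

theorem trace_Ad (U : Matrix.unitaryGroup n ℂ) (X : Matrix n n ℂ) : (Ad U X).trace = X.trace := by
  rw [Unitary.conjStarAlgAut_apply, Matrix.trace_mul_cycle, Unitary.coe_star_mul_self, one_mul]

theorem trace_star_mul_Ad_inv (U : Matrix.unitaryGroup n ℂ) (X Y : Matrix n n ℂ) :
    (star X * Ad U⁻¹ Y).trace = star (star Y * Ad U X).trace := by
  have hY : Ad U (Ad U⁻¹ Y) = Y := by
    rw [← Unitary.conjStarAlgAut_mul_apply, mul_inv_cancel, map_one, StarAlgEquiv.one_apply]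
  rw [← trace_Ad U, map_mul, map_star, hY, ← Matrix.trace_conjTranspose,
    ← Matrix.star_eq_conjTranspose, star_mul, star_star]

theorem commute_of_Ad_eq_self {U : Matrix.unitaryGroup n ℂ} {X : Matrix n n ℂ} (h : Ad U X = X) :
    Commute (U : Matrix n n ℂ) X := by
  calc (U : Matrix n n ℂ) * X = U * X * (star (U : Matrix n n ℂ) * U) := by
        rw [Unitary.coe_star_mul_self, mul_one]
    _ = Ad U X * U := by simp only [Unitary.conjStarAlgAut_apply, mul_assoc]
    _ = X * U := by rw [h]

theorem Ad_eq_self_of_commute {U : Matrix.unitaryGroup n ℂ} {X : Matrix n n ℂ}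
    (h : Commute (U : Matrix n n ℂ) X) : Ad U X = X := by
  rw [Unitary.conjStarAlgAut_apply, h.eq, mul_assoc, Matrix.mem_unitaryGroup_iff.mp U.2, mul_one]

theorem Ad_inv_eq_Ad_of_mul_fixed {U W : Matrix.unitaryGroup n ℂ} {X : Matrix n n ℂ}
    (h : Ad (U * W) X = X) : Ad U⁻¹ X = Ad W X := by
  conv_lhs => rw [← h]
  rw [← Unitary.conjStarAlgAut_mul_apply, inv_mul_cancel_left]

end AdjointAction

section Pauli

open Matrix

@[elab_as_elim]
theorem V.casesOn {motive : V → Prop} (v : V) (zero : motive 0) (x : motive (0, 1))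
    (y : motive (1, 1)) (z : motive (1, 0)) : motive v := by
  have hv : ∀ v : V, v = 0 ∨ v = (0, 1) ∨ v = (1, 1) ∨ v = (1, 0) := by decide
  obtain rfl | rfl | rfl | rfl := hv v <;> assumption

theorem V.sum_univ {M : Type*} [AddCommMonoid M] (f : V → M) :
    ∑ a, f a = f 0 + f (0, 1) + f (1, 1) + f (1, 0) := by
  have huniv : (Finset.univ : Finset V) = {0, (0, 1), (1, 1), (1, 0)} := by decide
  rw [huniv, Finset.sum_insert (by decide), Finset.sum_insert (by decide),
    Finset.sum_insert (by decide), Finset.sum_singleton, add_assoc, add_assoc]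

theorem pauliOf_zero : pauliOf 0 = 1 := by
  simp [pauliOf]

theorem pauliOf_zero_eq : pauliOf 0 = !![1, 0; 0, 1] := by
  rw [pauliOf_zero, Matrix.one_fin_two]

theorem pauliOf_x : pauliOf (0, 1) = !![0, 1; 1, 0] := by
  simp [pauliOf, pauliX, ZMod.val_one]

theorem pauliOf_y : pauliOf (1, 1) = !![0, 1; -1, 0] := by
  simp [pauliOf, pauliX, pauliZ, ZMod.val_one]

theorem pauliOf_z : pauliOf (1, 0) = !![1, 0; 0, -1] := by
  simp [pauliOf, pauliZ, ZMod.val_one]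

theorem star_pauliOf_mul_self (a : V) : star (pauliOf a) * pauliOf a = 1 := by
  cases a using V.casesOn <;>
    simp only [pauliOf_zero_eq, pauliOf_x, pauliOf_y, pauliOf_z, star_eq_conjTranspose] <;>
    ext i j <;> fin_cases i <;> fin_cases j <;> simp [Matrix.mul_apply]

/-- The symplectic form on `V`. -/
def form (a b : V) : ZMod 2 := a.1 * b.2 - a.2 * b.1

/-- The nontrivial character `ZMod 2 → {1, -1}`, with values in `ℂ`. -/
def sgn (a : ZMod 2) : ℂ := (-1) ^ a.val

theorem sgn_zero : sgn 0 = 1 := by simp [sgn]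

theorem sgn_one : sgn 1 = -1 := by simp [sgn, ZMod.val_one]

theorem sgn_add (a b : ZMod 2) : sgn (a + b) = sgn a * sgn b := by
  rw [sgn, ZMod.val_add, sgn, sgn, ← pow_add, ← neg_one_pow_eq_pow_mod_two]

theorem sgn_sum {ι : Type*} (s : Finset ι) (f : ι → ZMod 2) :
    sgn (∑ i ∈ s, f i) = ∏ i ∈ s, sgn (f i) := by
  classical
  induction s using Finset.induction_on with
  | empty => simp [sgn_zero]
  | insert a s ha ih => rw [Finset.sum_insert ha, Finset.prod_insert ha, sgn_add, ih]

theorem pauliOf_mul_comm (a b : V) :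
    pauliOf a * pauliOf b = sgn (form a b) • (pauliOf b * pauliOf a) := by
  have hform : ∀ a b : V, form a b = if a = 0 ∨ b = 0 ∨ a = b then 0 else 1 := by decide
  rw [hform]
  cases a using V.casesOn <;> cases b using V.casesOn <;>
    simp only [pauliOf_zero_eq, pauliOf_x, pauliOf_y, pauliOf_z] <;>
    ext i j <;> fin_cases i <;> fin_cases j <;> simp [Matrix.mul_apply, sgn_zero, sgn_one]

/-- The coefficient of `pauliOf a` in the expansion of `M` in the Pauli basis of all one-qubit
operators. -/
def pauliCoeff (M : Matrix (Fin 2) (Fin 2) ℂ) (a : V) : ℂ := (star (pauliOf a) * M).trace / 2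

theorem eq_sum_pauliOf (M : Matrix (Fin 2) (Fin 2) ℂ) : M = ∑ a, pauliCoeff M a • pauliOf a := by
  rw [V.sum_univ]
  simp only [pauliCoeff, pauliOf_zero_eq, pauliOf_x, pauliOf_y, pauliOf_z, star_eq_conjTranspose,
    trace_fin_two]
  ext i j
  fin_cases i <;> fin_cases j <;> simp [Matrix.mul_apply] <;> ring

theorem pauliCoeff_pauliOf (a b : V) : pauliCoeff (pauliOf b) a = if a = b then 1 else 0 := by
  have hx : (0 : V) ≠ (0, 1) := by decide
  have hy : (0 : V) ≠ (1, 1) := by decide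
  have hz : (0 : V) ≠ (1, 0) := by decide
  cases a using V.casesOn <;> cases b using V.casesOn <;>
    simp only [pauliCoeff, pauliOf_zero_eq, pauliOf_x, pauliOf_y, pauliOf_z,
      star_eq_conjTranspose, trace_fin_two] <;>
    simp [Matrix.mul_apply, hx, hy, hz]

theorem pauliCoeff_one (a : V) : pauliCoeff 1 a = if a = 0 then 1 else 0 := by
  rw [← pauliOf_zero, pauliCoeff_pauliOf]

theorem pauliCoeff_zero (M : Matrix (Fin 2) (Fin 2) ℂ) : pauliCoeff M 0 = M.trace / 2 := by
  rw [pauliCoeff, pauliOf_zero, star_one, one_mul]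

/-- The matrix coefficients of the adjoint action of `u` in the Pauli basis of all one-qubit
operators. -/
def adCoeff (u : U2) (a b : V) : ℂ := pauliCoeff (Ad u (pauliOf b)) a

theorem adCoeff_one (a b : V) : adCoeff 1 a b = if a = b then 1 else 0 := by
  rw [adCoeff, map_one, StarAlgEquiv.one_apply, pauliCoeff_pauliOf]

theorem adCoeff_zero_left (u : U2) (b : V) : adCoeff u 0 b = if b = 0 then 1 else 0 := by
  rw [adCoeff, pauliCoeff_zero, trace_Ad, ← pauliCoeff_zero, pauliCoeff_pauliOf]
  exact if_congr eq_comm rfl rfl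

theorem adCoeff_zero_right (u : U2) (a : V) : adCoeff u a 0 = if a = 0 then 1 else 0 := by
  rw [adCoeff, pauliOf_zero, map_one, pauliCoeff_one]

theorem adCoeff_eq_zero_of_not_iff (u : U2) {a b : V} (h : ¬(b = 0 ↔ a = 0)) :
    adCoeff u a b = 0 := by
  by_cases ha : a = 0
  · rw [ha, adCoeff_zero_left, if_neg (by tauto)]
  · have hb : b = 0 := by tauto
    rw [hb, adCoeff_zero_right, if_neg ha]

theorem adCoeff_inv (u : U2) (a b : V) : adCoeff u⁻¹ a b = star (adCoeff u b a) := by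
  rw [adCoeff, adCoeff, pauliCoeff, pauliCoeff, trace_star_mul_Ad_inv, star_div₀, star_ofNat]

end Pauli

section Represents

open Matrix

/-- The traceless Hermitian operator with coordinates `x` in the base `X, Y, Z`. -/
def pauliSum (x : Fin 3 → ℝ) : Matrix (Fin 2) (Fin 2) ℂ := ∑ i, (x i : ℂ) • pauliBase i

theorem pauliSum_eq (x : Fin 3 → ℝ) :
    pauliSum x = !![(x 2 : ℂ), x 0 - x 1 * Complex.I; x 0 + x 1 * Complex.I, -x 2] := by
  rw [pauliSum, Fin.sum_univ_three]
  ext a b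
  fin_cases a <;> fin_cases b <;> simp [pauliBase, pauliX, pauliY, pauliZ, sub_eq_add_neg]

theorem pauliSum_one (i : Fin 3) : pauliSum ((1 : Matrix (Fin 3) (Fin 3) ℝ) i) = pauliBase i := by
  simp [pauliSum, one_apply]

theorem star_pauliSum (x : Fin 3 → ℝ) : star (pauliSum x) = pauliSum x := by
  rw [pauliSum_eq, star_eq_conjTranspose]
  ext a b
  fin_cases a <;> fin_cases b <;> simp [sub_eq_add_neg]

theorem trace_pauliSum (x : Fin 3 → ℝ) : (pauliSum x).trace = 0 := by
  simp [pauliSum_eq, trace_fin_two]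

theorem exists_eq_pauliSum {H : Matrix (Fin 2) (Fin 2) ℂ} (hstar : star H = H)
    (htrace : H.trace = 0) : ∃ x, H = pauliSum x := by
  have h00 : star (H 0 0) = H 0 0 := congr($hstar 0 0)
  have h01 : star (H 1 0) = H 0 1 := congr($hstar 0 1)
  have h11 : H 1 1 = -H 0 0 := by
    rw [trace_fin_two] at htrace
    linear_combination htrace
  refine ⟨![(H 1 0).re, (H 1 0).im, (H 0 0).re], ?_⟩
  rw [pauliSum_eq]
  ext a b
  fin_cases a <;> fin_cases b <;> simp [h11, ← h01, Complex.conj_eq_iff_re.mp h00, Complex.ext_iff]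

theorem trace_pauliSum_mul (x y : Fin 3 → ℝ) :
    (pauliSum x * pauliSum y).trace = 2 * (x ⬝ᵥ y : ℝ) := by
  simp only [pauliSum_eq, trace_fin_two, Matrix.mul_apply, Fin.sum_univ_two, dotProduct,
    Fin.sum_univ_three, of_apply, cons_val_zero, cons_val_one, Complex.ofReal_add,
    Complex.ofReal_mul]
  linear_combination (-2 * (x 1 : ℂ) * y 1) * Complex.I_sq

theorem trace_pauliSum_mul_mul (M : Matrix (Fin 3) (Fin 3) ℝ) :
    (pauliSum (M 0) * pauliSum (M 1) * pauliSum (M 2)).trace = 2 * (M.det : ℝ) * Complex.I := by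
  simp only [pauliSum_eq, trace_fin_two, Matrix.mul_apply, Fin.sum_univ_two, det_fin_three,
    of_apply, cons_val_zero, cons_val_one, Complex.ofReal_add, Complex.ofReal_sub,
    Complex.ofReal_mul]
  ring_nf

theorem represents_iff {u : U2} {g : SO3} :
    Represents u g ↔ ∀ j, Ad u (pauliBase j) = pauliSum fun i => g.1 i j :=
  Iff.rfl

theorem exists_represents (u : U2) : ∃ g : SO3, Represents u g := by
  have hbase : ∀ j, ∃ x, Ad u (pauliBase j) = pauliSum x := fun j =>
    exists_eq_pauliSum (by rw [← map_star, ← pauliSum_one, star_pauliSum])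
      (by rw [trace_Ad, ← pauliSum_one, trace_pauliSum])
  obtain ⟨M, hM⟩ : ∃ M : Matrix (Fin 3) (Fin 3) ℝ, ∀ j, Ad u (pauliBase j) = pauliSum (M j) :=
    ⟨fun j => (hbase j).choose, fun j => (hbase j).choose_spec⟩
  have hdot (i j : Fin 3) : M i ⬝ᵥ M j = (1 : Matrix (Fin 3) (Fin 3) ℝ) i ⬝ᵥ
      (1 : Matrix (Fin 3) (Fin 3) ℝ) j := by
    have h : (2 : ℂ) * (M i ⬝ᵥ M j : ℝ) = 2 * (((1 : Matrix (Fin 3) (Fin 3) ℝ) i ⬝ᵥ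
        (1 : Matrix (Fin 3) (Fin 3) ℝ) j : ℝ) : ℂ) := by
      rw [← trace_pauliSum_mul, ← trace_pauliSum_mul, ← hM, ← hM, ← map_mul, trace_Ad,
        pauliSum_one, pauliSum_one]
    exact Complex.ofReal_injective (mul_left_cancel₀ two_ne_zero h)
  have horth : M * Mᵀ = 1 := by
    calc M * Mᵀ = 1 * 1ᵀ := by ext i j; exact hdot i j
      _ = 1 := by rw [transpose_one, one_mul]
  have hdet : M.det = 1 := by
    have h : 2 * (M.det : ℂ) * Complex.I =
        2 * ((1 : Matrix (Fin 3) (Fin 3) ℝ).det : ℂ) * Complex.I := by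
      rw [← trace_pauliSum_mul_mul, ← trace_pauliSum_mul_mul, ← hM, ← hM, ← hM, ← map_mul,
        ← map_mul, trace_Ad, pauliSum_one, pauliSum_one, pauliSum_one]
    rw [mul_left_inj' Complex.I_ne_zero, mul_right_inj' two_ne_zero, Complex.ofReal_inj,
      det_one] at h
    exact h
  exact ⟨⟨Mᵀ, mem_specialOrthogonalGroup_iff_mul_transpose.mpr
    ⟨mul_eq_one_comm.mp horth, (det_transpose M).trans hdet⟩⟩, hM⟩

theorem eq_smul_one_of_commute {M : Matrix (Fin 2) (Fin 2) ℂ} (hX : Commute M pauliX)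
    (hZ : Commute M pauliZ) : M = M 0 0 • 1 := by
  have h01 : -M 0 1 = M 0 1 := by
    simpa [pauliZ, Matrix.mul_apply] using congr($hZ.eq 0 1)
  have h10 : M 1 0 = -M 1 0 := by
    simpa [pauliZ, Matrix.mul_apply] using congr($hZ.eq 1 0)
  have h11 : M 0 0 = M 1 1 := by
    simpa [pauliX, Matrix.mul_apply] using congr($hX.eq 0 1)
  ext a b
  fin_cases a <;> fin_cases b <;> simp [neg_eq_self.mp h01, self_eq_neg.mp h10, h11]

theorem Represents.eq_smul {u w : U2} {g : SO3} (hu : Represents u g) (hw : Represents w g) :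
    ∃ c : ℂ, w.1 = c • u.1 := by
  have hone : Represents (u⁻¹ * w) 1 := by
    simpa only [inv_mul_cancel] using hu.inv.mul hw
  have hcomm (j : Fin 3) : Commute (u⁻¹ * w).1 (pauliBase j) := by
    refine commute_of_Ad_eq_self ((represents_iff.mp hone j).trans ?_)
    rw [← pauliSum_one]
    exact congrArg pauliSum (funext fun i => congr($(transpose_one (α := ℝ)) j i))
  refine ⟨(u⁻¹ * w).1 0 0, ?_⟩
  calc w.1 = u.1 * (u⁻¹ * w).1 := by rw [← Submonoid.coe_mul, mul_inv_cancel_left]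
    _ = u.1 * ((u⁻¹ * w).1 0 0 • 1) := by
      conv_lhs => rw [eq_smul_one_of_commute (hcomm 0) (hcomm 2)]
    _ = (u⁻¹ * w).1 0 0 • u.1 := by rw [mul_smul_comm, mul_one]

/-- The vector of `V` that corresponds to the `i`-th Pauli operator. -/
def axisVec : Fin 3 → V := ![(0, 1), (1, 1), (1, 0)]

theorem axisVec_ne_zero (i : Fin 3) : axisVec i ≠ 0 := by revert i; decide

theorem axisVec_injective : Function.Injective axisVec := by decide

theorem exists_axisVec_eq {a : V} (ha : a ≠ 0) : ∃ i, axisVec i = a := by revert a; decide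

theorem exists_pauliOf_axisVec_eq_smul (i : Fin 3) :
    ∃ c : ℂ, ‖c‖ = 1 ∧ pauliOf (axisVec i) = c • pauliBase i := by
  fin_cases i
  · exact ⟨1, norm_one, by simp [axisVec, pauliBase, pauliOf_x, pauliX]⟩
  · exact ⟨Complex.I, Complex.norm_I, by simp [axisVec, pauliBase, pauliOf_y, pauliY]⟩
  · exact ⟨1, norm_one, by simp [axisVec, pauliBase, pauliOf_z, pauliZ]⟩

theorem Represents.norm_adCoeff {u : U2} {g : SO3} (h : Represents u g) (i j : Fin 3) :
    ‖adCoeff u (axisVec i) (axisVec j)‖ = |g.1 i j| := by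
  obtain ⟨c, hc, hci⟩ := exists_pauliOf_axisVec_eq_smul i
  obtain ⟨d, hd, hdj⟩ := exists_pauliOf_axisVec_eq_smul j
  have htrace : (star (pauliBase i) * Ad u (pauliBase j)).trace = 2 * (g.1 i j : ℂ) := by
    rw [represents_iff.mp h j, ← pauliSum_one, star_pauliSum, trace_pauliSum_mul]
    congr 2
    exact congr($(one_mul g.1) i j)
  rw [adCoeff, pauliCoeff, hci, hdj, map_smul, star_smul, smul_mul_smul_comm, trace_smul, htrace,
    smul_eq_mul, norm_div, norm_mul, norm_mul, norm_mul, norm_star, hc, hd, Complex.norm_real,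
    Real.norm_eq_abs, Complex.norm_ofNat]
  ring

end Represents

section Tensor

open Matrix

variable {P : Type*} [Fintype P]

theorem tensorMat_smul (c : P → ℂ) (M : P → Matrix (Fin 2) (Fin 2) ℂ) :
    (tensorMat fun p => c p • M p) = (∏ p, c p) • tensorMat M := by
  ext a b
  simp [tensorMat, Finset.prod_mul_distrib]

/-- The tensor product of Pauli operators given by a vector of `V ^ P`. -/
def pauliTensor (v : P → V) : Matrix (P → Fin 2) (P → Fin 2) ℂ :=
  tensorMat fun p => pauliOf (v p)

variable [DecidableEq P]

theorem trace_tensorMat (M : P → Matrix (Fin 2) (Fin 2) ℂ) :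
    (tensorMat M).trace = ∏ p, (M p).trace := by
  simp only [Matrix.trace, tensorMat, diag_apply, of_apply]
  rw [Fintype.prod_sum]

theorem tensorMat_sum {ι : Type*} [Fintype ι] (M : P → ι → Matrix (Fin 2) (Fin 2) ℂ) :
    (tensorMat fun p => ∑ i, M p i) = ∑ w : P → ι, tensorMat fun p => M p (w p) := by
  ext a b
  simp only [tensorMat, of_apply, Matrix.sum_apply]
  rw [Fintype.prod_sum]

theorem tensorMat_eq_sum_pauliTensor (M : P → Matrix (Fin 2) (Fin 2) ℂ) :
    tensorMat M = ∑ w : P → V, (∏ p, pauliCoeff (M p) (w p)) • pauliTensor w := by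
  calc tensorMat M = tensorMat fun p => ∑ a, pauliCoeff (M p) a • pauliOf a :=
        congrArg tensorMat (funext fun p => eq_sum_pauliOf (M p))
    _ = _ := by
      rw [tensorMat_sum]
      exact Finset.sum_congr rfl fun w _ => tensorMat_smul _ _

theorem star_pauliTensor_mul_self (v : P → V) : star (pauliTensor v) * pauliTensor v = 1 := by
  rw [pauliTensor, tensorMat_star, ← tensorMat_mul, ← tensorMat_one]
  exact congrArg tensorMat (funext fun p => star_pauliOf_mul_self (v p))

theorem pauliTensor_mul_comm (v w : P → V) :
    pauliTensor v * pauliTensor w = sgn (omega v w) • (pauliTensor w * pauliTensor v) := by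
  rw [pauliTensor, pauliTensor, ← tensorMat_mul, ← tensorMat_mul, omega, sgn_sum, ← tensorMat_smul]
  exact congrArg tensorMat (funext fun p => pauliOf_mul_comm (v p) (w p))

theorem coe_tensorU (u : P → U2) :
    ((tensorU u : UnitaryOn P) : Matrix (P → Fin 2) (P → Fin 2) ℂ) =
      tensorMat fun p => (u p).1 := rfl

theorem Ad_tensorU_pauliTensor (u : P → U2) (v : P → V) :
    Ad (tensorU u) (pauliTensor v) = tensorMat fun p => Ad (u p) (pauliOf (v p)) := by
  rw [Unitary.conjStarAlgAut_apply, coe_tensorU, pauliTensor, tensorMat_star, ← tensorMat_mul,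
    ← tensorMat_mul]
  rfl

theorem trace_star_pauliTensor_mul_tensorMat (w : P → V) (M : P → Matrix (Fin 2) (Fin 2) ℂ) :
    (star (pauliTensor w) * tensorMat M).trace =
      2 ^ Fintype.card P * ∏ p, pauliCoeff (M p) (w p) := by
  rw [pauliTensor, tensorMat_star, ← tensorMat_mul, trace_tensorMat, ← Finset.card_univ,
    ← Finset.prod_const, ← Finset.prod_mul_distrib]
  exact Finset.prod_congr rfl fun p _ => (mul_div_cancel₀ _ two_ne_zero).symm

theorem ofLp_act (U : UnitaryOn P) (ψ : StateSpace P) : (act U ψ).ofLp = U.1 *ᵥ ψ.ofLp := rfl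

end Tensor

section Stabilizer

open Matrix

variable {P : Type*} [Fintype P] [DecidableEq P] {L : Submodule (ZMod 2) (P → V)} (σ : Sec L)

instance fintypeSubspace : Fintype L := Fintype.ofFinite L

/-- The matrix of the stabilizer `σ v`. -/
def stabMat (v : L) : Matrix (P → Fin 2) (P → Fin 2) ℂ :=
  (σ.hom (Multiplicative.ofAdd v) : UnitaryOn P).1

theorem stabMat_add (v w : L) : stabMat σ (v + w) = stabMat σ v * stabMat σ w := by
  simp only [stabMat, ofAdd_add, map_mul]
  rfl

theorem stabMat_zero : stabMat σ 0 = 1 := by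
  simp only [stabMat, ofAdd_zero, map_one]
  rfl

theorem star_stabMat (v : L) : star (stabMat σ v) = stabMat σ v := by
  have hneg : star (stabMat σ v) = stabMat σ (-v) := by
    simp only [stabMat, ofAdd_neg, map_inv]
    rfl
  rw [hneg, ZModModule.neg_eq_self]

theorem exists_stabMat_eq_smul (v : L) : ∃ c : ℂ, ‖c‖ = 1 ∧ stabMat σ v = c • pauliTensor v.1 := by
  obtain ⟨c, hc⟩ : ∃ c : ℂ, stabMat σ v = c • pauliTensor v.1 := σ.liesOver v
  refine ⟨c, ?_, hc⟩
  have hunit : star (stabMat σ v) * stabMat σ v = 1 := by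
    rw [star_stabMat, ← stabMat_add, ZModModule.add_self, stabMat_zero]
  rw [hc, star_smul, smul_mul_smul_comm, star_pauliTensor_mul_self] at hunit
  have hsq : star c * c = 1 := by
    simpa only [Matrix.smul_apply, Matrix.one_apply_eq, smul_eq_mul, mul_one] using
      congr($hunit 0 0)
  exact CStarRing.norm_of_mem_unitary
    (Unitary.mem_iff.mpr ⟨hsq, (mul_comm c (star c)).trans hsq⟩)

/-- The phase of the stabilizer `σ v` relative to `pauliTensor v`. -/
def stabPhase (v : L) : ℂ := (exists_stabMat_eq_smul σ v).choose

theorem norm_stabPhase (v : L) : ‖stabPhase σ v‖ = 1 :=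
  (exists_stabMat_eq_smul σ v).choose_spec.1

theorem stabMat_eq (v : L) : stabMat σ v = stabPhase σ v • pauliTensor v.1 :=
  (exists_stabMat_eq_smul σ v).choose_spec.2

theorem stabPhase_ne_zero (v : L) : stabPhase σ v ≠ 0 :=
  norm_ne_zero_iff.mp ((norm_stabPhase σ v).trans_ne one_ne_zero)

theorem mem_code_iff {ψ : StateSpace P} :
    ψ ∈ code σ ↔ ∀ v : L, stabMat σ v *ᵥ ψ.ofLp = ψ.ofLp := by
  refine forall_congr' fun v => ?_
  rw [← (WithLp.ofLp_injective 2).eq_iff, ofLp_act]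
  rfl

/-- The sum of all stabilizers, which is `|L|` times the orthogonal projection to the code. -/
def stabSum : Matrix (P → Fin 2) (P → Fin 2) ℂ := ∑ v : L, stabMat σ v

theorem stabMat_mul_stabSum (v : L) : stabMat σ v * stabSum σ = stabSum σ := by
  rw [stabSum, Finset.mul_sum]
  simp only [← stabMat_add]
  exact Equiv.sum_comp (Equiv.addLeft v) fun w => stabMat σ w

theorem star_stabSum : star (stabSum σ) = stabSum σ := by
  simp only [stabSum, star_sum, star_stabMat]

/-- The operator `U` maps the code `C(L, σ)` into itself. -/
def PreservesCode (U : UnitaryOn P) : Prop := ∀ ψ ∈ code σ, act U ψ ∈ code σ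

variable {σ}

theorem stabSum_mul_mul_stabSum {U : UnitaryOn P} (hU : PreservesCode σ U) :
    stabSum σ * (U.1 * stabSum σ) = (Fintype.card L : ℂ) • (U.1 * stabSum σ) := by
  have hfix (v : L) : stabMat σ v * (U.1 * stabSum σ) = U.1 * stabSum σ := by
    refine ext_iff_mulVec.mpr fun x => ?_
    have hx : WithLp.toLp 2 (stabSum σ *ᵥ x) ∈ code σ :=
      (mem_code_iff σ).mpr fun w => by rw [mulVec_mulVec, stabMat_mul_stabSum]
    simpa only [ofLp_act, mulVec_mulVec, mul_assoc] using (mem_code_iff σ).mp (hU _ hx) v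
  calc stabSum σ * (U.1 * stabSum σ) = ∑ v : L, stabMat σ v * (U.1 * stabSum σ) :=
        Finset.sum_mul ..
    _ = _ := by rw [Finset.sum_congr rfl fun v _ => hfix v, Finset.sum_const, Finset.card_univ,
      ← Nat.cast_smul_eq_nsmul ℂ]

theorem Ad_stabSum {U : UnitaryOn P} (hU : PreservesCode σ U) : Ad U (stabSum σ) = stabSum σ := by
  have hright := stabSum_mul_mul_stabSum hU
  have hleft : stabSum σ * (U.1 * stabSum σ) = (Fintype.card L : ℂ) • (stabSum σ * U.1) := by
    have h := congrArg star (stabSum_mul_mul_stabSum (act_inv_mem _ _ hU))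
    rwa [star_mul, star_smul, star_natCast, star_mul, star_stabSum, mul_assoc,
      show star (U⁻¹ : UnitaryOn P).1 = U.1 from star_star U.1] at h
  exact Ad_eq_self_of_commute
    (smul_right_injective _ (Nat.cast_ne_zero.mpr Fintype.card_ne_zero) (hright.symm.trans hleft))

theorem trace_star_pauliTensor_mul_Ad_stabSum (x : P → U2) (w : P → V) :
    (star (pauliTensor w) * Ad (tensorU x) (stabSum σ)).trace =
      2 ^ Fintype.card P * ∑ v : L, stabPhase σ v * ∏ p, adCoeff (x p) (w p) (v.1 p) := by
  rw [stabSum, map_sum, Finset.mul_sum, trace_sum, Finset.mul_sum]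
  refine Finset.sum_congr rfl fun v _ => ?_
  rw [stabMat_eq, map_smul, mul_smul_comm, trace_smul, Ad_tensorU_pauliTensor,
    trace_star_pauliTensor_mul_tensorMat, smul_eq_mul, mul_left_comm]
  rfl

-- Compare the `w`-coefficients of `u_p⁻¹ Π u_p` and `u' Π u'⁻¹`, where `u'` is the product of the
-- `u_q` with `q ≠ p` and `Π = stabSum σ` commutes with `u = u_p u'`.
theorem sum_star_adCoeff_eq_sum_prod_adCoeff {u : P → U2} (hu : PreservesCode σ (tensorU u))
    (p : P) (w : P → V) :
    ∑ v : L with ∀ q ≠ p, v.1 q = w q, stabPhase σ v * star (adCoeff (u p) (v.1 p) (w p)) =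
      ∑ v : L with v.1 p = w p,
        stabPhase σ v * ∏ q ∈ Finset.univ.erase p, adCoeff (u q) (w q) (v.1 q) := by
  have hsplit : u = Pi.mulSingle p (u p) * Function.update u p 1 := by
    funext q
    obtain rfl | hq := eq_or_ne q p <;> simp [*]
  have hAd : Ad (tensorU (Pi.mulSingle p (u p)⁻¹)) (stabSum σ) =
      Ad (tensorU (Function.update u p 1)) (stabSum σ) := by
    rw [Pi.mulSingle_inv, map_inv]
    exact Ad_inv_eq_Ad_of_mul_fixed (by rw [← map_mul, ← hsplit, Ad_stabSum hu])
  have htrace := congr((star (pauliTensor w) * $hAd).trace)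
  rw [trace_star_pauliTensor_mul_Ad_stabSum, trace_star_pauliTensor_mul_Ad_stabSum,
    mul_right_inj' (pow_ne_zero _ two_ne_zero)] at htrace
  rw [Finset.sum_filter, Finset.sum_filter]
  refine Eq.trans (Finset.sum_congr rfl fun v _ => ?_)
    (htrace.trans (Finset.sum_congr rfl fun v _ => ?_))
  · have hoff : ∏ q ∈ Finset.univ.erase p,
        adCoeff ((Pi.mulSingle p (u p)⁻¹ : P → U2) q) (w q) (v.1 q) =
        if ∀ q ≠ p, v.1 q = w q then 1 else 0 := by
      rw [Finset.prod_congr rfl fun q hq => by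
        rw [Pi.mulSingle_eq_of_ne (Finset.ne_of_mem_erase hq), adCoeff_one], Finset.prod_ite_zero,
        Finset.prod_const_one]
      simp only [Finset.mem_erase, Finset.mem_univ, and_true, eq_comm]
    rw [← Finset.mul_prod_erase _ _ (Finset.mem_univ p), Pi.mulSingle_eq_same, adCoeff_inv, hoff,
      mul_ite, mul_one, mul_zero, mul_ite, mul_zero]
  · rw [← Finset.mul_prod_erase _ _ (Finset.mem_univ p), Function.update_self, adCoeff_one,
      ite_mul, one_mul, zero_mul, mul_ite, mul_zero]
    refine if_congr eq_comm (congrArg _ (Finset.prod_congr rfl fun q hq => ?_)) rfl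
    rw [Function.update_of_ne (Finset.ne_of_mem_erase hq)]

theorem prod_erase_adCoeff_eq_zero (u : P → U2) {p : P} {v w : P → V}
    (h : ¬∀ q ≠ p, (w q = 0 ↔ v q = 0)) :
    ∏ q ∈ Finset.univ.erase p, adCoeff (u q) (v q) (w q) = 0 := by
  push Not at h
  obtain ⟨q, hq, hne⟩ := h
  exact Finset.prod_eq_zero (Finset.mem_erase.mpr ⟨hq, Finset.mem_univ q⟩)
    (adCoeff_eq_zero_of_not_iff _ (by tauto))

theorem stabPhase_mul_star_adCoeff_eq_sum {u : P → U2} (hu : PreservesCode σ (tensorU u)) {p : P}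
    {v₀ : L} {b : V} (hb : b ≠ 0)
    (huniq : ∀ v : L, v.1 p ≠ 0 → (∀ q ≠ p, v.1 q = v₀.1 q) → v = v₀) :
    stabPhase σ v₀ * star (adCoeff (u p) (v₀.1 p) b) =
      ∑ v : L with v.1 p = b ∧ ∀ q ≠ p, (v.1 q = 0 ↔ v₀.1 q = 0),
        stabPhase σ v * ∏ q ∈ Finset.univ.erase p, adCoeff (u q) (v₀.1 q) (v.1 q) := by
  have h := sum_star_adCoeff_eq_sum_prod_adCoeff hu p (Function.update v₀.1 p b)
  have hoff {q : P} (hq : q ≠ p) : Function.update v₀.1 p b q = v₀.1 q :=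
    Function.update_of_ne hq ..
  rw [Function.update_self, Finset.sum_eq_single v₀] at h
  · rw [h, ← Finset.filter_filter, Finset.sum_filter (fun v : L => ∀ q ≠ p, _)]
    refine Finset.sum_congr rfl fun v _ => ?_
    rw [Finset.prod_congr rfl fun q hq => by rw [hoff (Finset.ne_of_mem_erase hq)]]
    split_ifs with hv
    · rfl
    · rw [prod_erase_adCoeff_eq_zero u hv, mul_zero]
  · intro v hv hne
    have hvp : v.1 p = 0 := by
      by_contra hvp
      exact hne (huniq v hvp fun q hq => ((Finset.mem_filter.mp hv).2 q hq).trans (hoff hq))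
    rw [hvp, adCoeff_zero_left, if_neg hb, star_zero, mul_zero]
  · intro hv
    exact absurd (Finset.mem_filter.mpr ⟨Finset.mem_univ _, fun q hq => (hoff hq).symm⟩) hv

theorem adCoeff_eq_zero_of_isolated {u : P → U2} (hu : PreservesCode σ (tensorU u)) {p : P}
    {v₀ : L} {b : V} (hb : b ≠ 0)
    (huniq : ∀ v : L, v.1 p ≠ 0 → (∀ q ≠ p, v.1 q = v₀.1 q) → v = v₀)
    (hnone : ∀ v : L, v.1 p = b → ∃ q ≠ p, ¬(v.1 q = 0 ↔ v₀.1 q = 0)) :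
    adCoeff (u p) (v₀.1 p) b = 0 := by
  have h := stabPhase_mul_star_adCoeff_eq_sum hu hb huniq
  rw [Finset.filter_eq_empty_iff.mpr, Finset.sum_empty, mul_eq_zero, star_eq_zero] at h
  · exact h.resolve_left (stabPhase_ne_zero σ v₀)
  · rintro v - ⟨hvp, hv⟩
    obtain ⟨q, hq, hne⟩ := hnone v hvp
    exact hne (hv q hq)

theorem norm_adCoeff_eq_prod {u : P → U2} (hu : PreservesCode σ (tensorU u)) {p : P} {v₀ v₁ : L}
    (hne : v₁.1 p ≠ 0)
    (huniq : ∀ v : L, v.1 p ≠ 0 → (∀ q ≠ p, v.1 q = v₀.1 q) → v = v₀)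
    (hone : ∀ v : L, v.1 p = v₁.1 p → (∀ q ≠ p, (v.1 q = 0 ↔ v₀.1 q = 0)) → v = v₁) :
    ‖adCoeff (u p) (v₀.1 p) (v₁.1 p)‖ =
      ∏ q ∈ Finset.univ.erase p, ‖adCoeff (u q) (v₀.1 q) (v₁.1 q)‖ := by
  have h := stabPhase_mul_star_adCoeff_eq_sum hu hne huniq
  rw [Finset.sum_eq_single v₁] at h
  · simpa only [norm_mul, norm_stabPhase, norm_star, norm_prod, one_mul] using congr(‖$h‖)
  · intro v hv hne
    obtain ⟨-, hvp, hv⟩ := Finset.mem_filter.mp hv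
    exact absurd (hone v hvp hv) hne
  · intro hv
    rw [Finset.mem_filter, and_iff_right (Finset.mem_univ _), and_iff_right rfl] at hv
    rw [prod_erase_adCoeff_eq_zero u hv, mul_zero]

end Stabilizer

section LocalTypes

theorem abs_entry_le_one {n : Type*} [Fintype n] [DecidableEq n]
    (g : Matrix.specialOrthogonalGroup n ℝ) (i j : n) : |g.1 i j| ≤ 1 :=
  entry_norm_bound_of_unitary (Matrix.mem_specialUnitaryGroup_iff.mp g.2).1 i j

theorem mem_integralRotations_of_off_diag {n : Type*} [Fintype n] [DecidableEq n]
    {g : Matrix.specialOrthogonalGroup n ℝ} (h : ∀ i j, i ≠ j → ∃ m : ℤ, g.1 i j = m) :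
    g ∈ integralRotations n := by
  intro i j
  obtain rfl | hij := eq_or_ne i j
  · choose! m hm using h
    obtain ⟨k, hk⟩ : ∃ k : ℤ, g.1 i i * g.1 i i = k := by
      refine ⟨1 - ∑ j ∈ Finset.univ.erase i, m i j * m i j, ?_⟩
      have hrow : ∑ j, g.1 i j * g.1 i j = 1 := (row_dotProduct_row g i i).trans (if_pos rfl)
      rw [← Finset.add_sum_erase _ _ (Finset.mem_univ i)] at hrow
      push_cast
      refine (eq_sub_of_add_eq hrow).trans (congrArg _ (Finset.sum_congr rfl fun j hj => ?_))
      rw [hm i j (Finset.ne_of_mem_erase hj).symm]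
    have hk0 : 0 ≤ k := by exact_mod_cast hk ▸ mul_self_nonneg (g.1 i i)
    have hk1 : k ≤ 1 := by
      exact_mod_cast hk ▸ abs_le_one_iff_mul_self_le_one.mp (abs_entry_le_one g i i)
    obtain rfl | rfl : k = 0 ∨ k = 1 := by lia
    · exact ⟨0, by simpa using hk⟩
    · obtain h1 | h1 := mul_self_eq_one_iff.mp (hk.trans Int.cast_one)
      · exact ⟨1, by simpa using h1⟩
      · exact ⟨-1, by simpa using h1⟩
  · exact h i j hij

theorem eq_zero_or_one_of_eq_prod_erase {ι : Type*} [Fintype ι] [DecidableEq ι] {m : ι → ℝ}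
    (h0 : ∀ x, 0 ≤ m x) (h1 : ∀ x, m x ≤ 1) {p q r : ι} (hpq : p ≠ q) (hpr : p ≠ r) (hqr : q ≠ r)
    (hp : m p = ∏ x ∈ Finset.univ.erase p, m x) (hq : m q = ∏ x ∈ Finset.univ.erase q, m x)
    (hr : m r = ∏ x ∈ Finset.univ.erase r, m x) : m p = 0 ∨ m p = 1 := by
  have hle {x y z : ι} (hxy : x ≠ y) (hxz : x ≠ z) (hyz : y ≠ z)
      (hx : m x = ∏ w ∈ Finset.univ.erase x, m w) : m x ≤ m y * m z := by
    rw [hx, ← Finset.prod_pair hyz]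
    refine Finset.prod_le_prod_of_subset_of_le_one ?_ (fun w _ => h0 w) fun w _ _ => h1 w
    simp [Finset.insert_subset_iff, hxy.symm, hxz.symm]
  refine or_iff_not_imp_left.mpr fun hne => ?_
  have hpos : 0 < m p := (h0 p).lt_of_ne' hne
  have hr1 : m r = 1 := by
    refine le_antisymm (h1 r) (le_of_mul_le_mul_left ?_ hpos)
    calc m p * 1 ≤ m q * m r := (mul_one _).trans_le (hle hpq hpr hqr hp)
      _ ≤ m q := mul_le_of_le_one_right (h0 q) (h1 r)
      _ ≤ m p * m r := hle hpq.symm hqr hpr hq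
  refine le_antisymm (h1 p) ?_
  calc 1 = m r := hr1.symm
    _ ≤ m p * m q := hle hpr.symm hqr.symm hpq hr
    _ ≤ m p := mul_le_of_le_one_right (h0 p) (h1 q)

theorem Represents.norm_adCoeff_le_one {u : U2} {g : SO3} (h : Represents u g) {a b : V}
    (hab : a = 0 ↔ b = 0) : ‖adCoeff u a b‖ ≤ 1 := by
  obtain rfl | ha := eq_or_ne a 0
  · rw [adCoeff_zero_left, if_pos (hab.mp rfl), norm_one]
  obtain ⟨i, rfl⟩ := exists_axisVec_eq ha
  obtain ⟨j, rfl⟩ := exists_axisVec_eq (mt hab.mpr ha)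
  rw [h.norm_adCoeff]
  exact abs_entry_le_one g i j

section

variable {P : Type*} {L : Submodule (ZMod 2) (P → V)}

theorem mem_part_iff {S : Set P} {v : P → V} :
    v ∈ part L S ↔ v ∈ L ∧ Function.support v ⊆ S := by
  simp only [part, Submodule.mem_inf, supportedOn, Function.support_subset_iff']
  rfl

theorem exists_ne_zero_of_not_splits (hzero : ¬SplitsOffZeroFactor L) (p : P) :
    ∃ v ∈ L, v p ≠ 0 := by
  by_contra! hp
  refine hzero ⟨{p}, Set.singleton_nonempty p, ?_, ?_⟩
  · refine le_antisymm (le_trans (fun v hv => ?_) le_sup_right) (sup_le inf_le_left inf_le_left)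
    refine mem_part_iff.mpr ⟨hv, fun q hq hqp => hq ?_⟩
    rw [Set.mem_singleton_iff.mp hqp]
    exact hp v hv
  · refine eq_bot_iff.mpr fun v hv => funext fun q => ?_
    obtain ⟨hvL, hvS⟩ := mem_part_iff.mp hv
    by_contra hq
    obtain rfl : q = p := hvS hq
    exact hq (hp v hvL)

theorem exists_minimal_support [Finite P] (hzero : ¬SplitsOffZeroFactor L) (p : P) :
    ∃ v₀ ∈ L, v₀ p ≠ 0 ∧ ∀ v ∈ part L (Function.support v₀), v p ≠ 0 →
      Function.support v = Function.support v₀ := by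
  obtain ⟨v₀, ⟨hv₀, hp⟩, hmin⟩ := (Set.toFinite {v | v ∈ L ∧ v p ≠ 0}).exists_minimalFor
    Function.support _ (exists_ne_zero_of_not_splits hzero p)
  refine ⟨v₀, hv₀, hp, fun v hv hvp => ?_⟩
  obtain ⟨hvL, hsub⟩ := mem_part_iff.mp hv
  exact hsub.antisymm (hmin ⟨hvL, hvp⟩ hsub)

/-- The evaluation of `L_S` at each qubit of `S` is bijective: the nonzero vectors of `L_S` have
support `S`, and each nonzero vector of `V` occurs at each qubit of `S` in exactly one of them. -/
def IsFull (L : Submodule (ZMod 2) (P → V)) (S : Set P) : Prop :=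
  ∀ s ∈ S, Function.Bijective fun v : part L S => v.1 s

namespace IsFull

variable {S : Set P} {s : P}

theorem exists_apply_eq (h : IsFull L S) (hs : s ∈ S) (a : V) : ∃ v ∈ part L S, v s = a := by
  obtain ⟨v, hv⟩ := (h s hs).2 a
  exact ⟨v, v.2, hv⟩

theorem eq_of_apply_eq (h : IsFull L S) (hs : s ∈ S) {v w : P → V} (hv : v ∈ part L S)
    (hw : w ∈ part L S) (hvw : v s = w s) : v = w :=
  congrArg Subtype.val (@(h s hs).1 ⟨v, hv⟩ ⟨w, hw⟩ hvw)

theorem support_eq (h : IsFull L S) {v : P → V} (hv : v ∈ part L S) (hne : v ≠ 0) :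
    Function.support v = S :=
  (mem_part_iff.mp hv).2.antisymm fun _ hs hvs => hne (h.eq_of_apply_eq hs hv (zero_mem _) hvs)

end IsFull

theorem isFull_support {p : P} {v₀ v₁ : P → V} (hv₀ : v₀ ∈ L) (h₀ : v₀ p ≠ 0)
    (hmin : ∀ v ∈ part L (Function.support v₀), v p ≠ 0 →
      Function.support v = Function.support v₀)
    (hv₁ : v₁ ∈ part L (Function.support v₀)) (h₁ : v₁ p ≠ 0) (hne : v₀ p ≠ v₁ p) :
    IsFull L (Function.support v₀) := by
  set S := Function.support v₀
  have hv₀' : v₀ ∈ part L S := mem_part_iff.mpr ⟨hv₀, subset_rfl⟩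
  have hsupp {v : P → V} (hv : v ∈ part L S) (hvp : v p ≠ 0) {q : P} (hq : q ∈ S) : v q ≠ 0 := by
    rwa [← hmin v hv hvp] at hq
  have hadd : (v₀ + v₁) p ≠ 0 := mt CharTwo.add_eq_zero.mp hne
  have hsurj {q : P} (hq : q ∈ S) {a : V} (ha : a ≠ 0) : ∃ w ∈ part L S, w p ≠ 0 ∧ w q = a := by
    have hneq : v₀ q ≠ v₁ q :=
      mt CharTwo.add_eq_zero.mpr (hsupp (add_mem hv₀' hv₁) hadd hq)
    have hcases : ∀ {a b c : V}, a ≠ 0 → b ≠ 0 → a ≠ b → c ≠ 0 → c = a ∨ c = b ∨ c = a + b := by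
      decide
    obtain rfl | rfl | rfl := hcases (hsupp hv₀' h₀ hq) (hsupp hv₁ h₁ hq) hneq ha
    · exact ⟨v₀, hv₀', h₀, rfl⟩
    · exact ⟨v₁, hv₁, h₁, rfl⟩
    · exact ⟨v₀ + v₁, add_mem hv₀' hv₁, hadd, rfl⟩
  have hinj {v : P → V} (hv : v ∈ part L S) {s : P} (hs : s ∈ S) (hvs : v s = 0) : v = 0 := by
    have hvp : v p = 0 := by
      by_contra hvp
      exact hsupp hv hvp hs hvs
    by_contra! hne
    obtain ⟨q, hq⟩ := Function.ne_iff.mp hne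
    have hqS : q ∈ S := (mem_part_iff.mp hv).2 hq
    obtain ⟨w, hw, hwp, hwq⟩ := hsurj hqS hq
    refine hsupp (add_mem hv hw) ?_ hqS (CharTwo.add_eq_zero.mpr hwq.symm)
    rwa [Pi.add_apply, hvp, zero_add]
  refine fun s hs => ⟨fun v w hvw => ?_, fun a => ?_⟩
  · exact Subtype.ext (sub_eq_zero.mp (hinj (sub_mem v.2 w.2) hs (sub_eq_zero.mpr hvw)))
  · obtain rfl | ha := eq_or_ne a 0
    · exact ⟨0, rfl⟩
    · obtain ⟨w, hw, -, hws⟩ := hsurj hs ha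
      exact ⟨⟨w, hw⟩, hws⟩

end

section

variable {P : Type*} [Fintype P] {L : Submodule (ZMod 2) (P → V)} {S : Set P}

theorem IsFull.exists_ne (h : IsFull L S) (hL : IsIsotropic L) {p : P} (hp : p ∈ S) :
    ∃ q ∈ S, q ≠ p := by
  by_contra! hcon
  obtain ⟨v, hv, hvp⟩ := h.exists_apply_eq hp (0, 1)
  obtain ⟨w, hw, hwp⟩ := h.exists_apply_eq hp (1, 0)
  obtain ⟨hvL, hvS⟩ := mem_part_iff.mp hv
  have homega := hL v hvL w (mem_part_iff.mp hw).1
  rw [omega, Finset.sum_eq_single_of_mem p (Finset.mem_univ p), hvp, hwp] at homega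
  · simp at homega
  · intro q _ hq
    rw [show v q = 0 from not_not.mp fun hvq => hq (hcon q (hvS hvq))]
    simp

theorem omega_add_right (v w x : P → V) : omega v (w + x) = omega v w + omega v x := by
  rw [omega, omega, omega, ← Finset.sum_add_distrib]
  refine Finset.sum_congr rfl fun p _ => ?_
  rw [Pi.add_apply, Prod.fst_add, Prod.snd_add]
  ring

/-- Every vector of `V ^ S` orthogonal to `L_S` belongs to `L`. For isotropic `L` this means that
`L_S` is a Lagrangian subspace of `V ^ S`, so that the qubits in `S` carry a fixed state. -/
def IsLagrangianOn (L : Submodule (ZMod 2) (P → V)) (S : Set P) : Prop :=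
  ∀ w ∈ supportedOn S, (∀ v ∈ part L S, omega v w = 0) → w ∈ L

theorem isLagrangianOn_empty : IsLagrangianOn L ∅ := fun w hw _ => by
  rw [show w = 0 from funext fun p => hw p (Set.notMem_empty p)]
  exact zero_mem L

theorem IsLagrangianOn.union (hL : IsIsotropic L) {S T : Set P} (hS : IsLagrangianOn L S)
    (hT : IsLagrangianOn L T) : IsLagrangianOn L (S ∪ T) := by
  classical
  intro w hw horth
  have hwS : S.indicator w ∈ L := by
    refine hS _ (fun p hp => Set.indicator_of_notMem hp w) fun v hv => ?_
    rw [← horth v ⟨hv.1, fun p hp => hv.2 p (mt Or.inl hp)⟩]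
    refine Finset.sum_congr rfl fun p _ => ?_
    by_cases hp : p ∈ S
    · rw [Set.indicator_of_mem hp]
    · rw [hv.2 p hp]
      simp
  have hwT : w + S.indicator w ∈ L := by
    refine hT _ (fun p hp => ?_) fun v hv => ?_
    · by_cases hpS : p ∈ S
      · rw [Pi.add_apply, Set.indicator_of_mem hpS, CharTwo.add_self_eq_zero]
      · rw [Pi.add_apply, Set.indicator_of_notMem hpS, add_zero, hw p (not_or.mpr ⟨hpS, hp⟩)]
    · rw [omega_add_right, horth v ⟨hv.1, fun p hp => hv.2 p (mt Or.inr hp)⟩,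
        hL v hv.1 _ hwS, add_zero]
  rw [← add_zero w, ← ZModModule.add_self (S.indicator w), ← add_assoc]
  exact add_mem hwT hwS

theorem exists_isGreatest_isLagrangianOn (hL : IsIsotropic L) :
    ∃ S, IsGreatest {S | IsLagrangianOn L S} S := by
  obtain ⟨S, hS⟩ := (Set.toFinite {S | IsLagrangianOn L S}).exists_maximal
    ⟨∅, isLagrangianOn_empty⟩
  exact ⟨S, hS.1, fun T hT => Set.subset_union_right.trans
    (hS.le_of_ge (hS.1.union hL hT) Set.subset_union_left)⟩

theorem IsFull.isLagrangianOn_pair (hL : IsIsotropic L) {p q : P} (h : IsFull L {p, q}) :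
    IsLagrangianOn L {p, q} := by
  intro w hw horth
  obtain ⟨v, hv, hvp⟩ := h.exists_apply_eq (Set.mem_insert p _) (w p)
  suffices w = v from this ▸ hv.1
  have hoff {r : P} (hr : r ≠ q) : (w + v) r = 0 := by
    rw [Pi.add_apply, CharTwo.add_eq_zero]
    obtain rfl | hrp := eq_or_ne r p
    · exact hvp.symm
    · have hnot : r ∉ ({p, q} : Set P) := by simp [hrp, hr]
      rw [hw r hnot, hv.2 r hnot]
  have hform (a : V) : form a ((w + v) q) = 0 := by
    obtain ⟨x, hx, rfl⟩ := h.exists_apply_eq (Set.mem_insert_of_mem p (Set.mem_singleton q)) a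
    have homega : ∑ r, form (x r) ((w + v) r) = 0 := by
      refine (omega_add_right x w v).trans ?_
      rw [horth x hx, hL x hx.1 v hv.1, add_zero]
    rwa [Finset.sum_eq_single_of_mem q (Finset.mem_univ q) fun r _ hr => by
      rw [hoff hr]; simp [form]] at homega
  have hnondeg : ∀ {b : V}, (∀ a, form a b = 0) → b = 0 := by decide
  funext r
  refine CharTwo.add_eq_zero.mp (?_ : (w + v) r = 0)
  obtain rfl | hr := eq_or_ne r q
  exacts [hnondeg hform, hoff hr]

variable [DecidableEq P] {σ : Sec L}

theorem IsFull.norm_adCoeff_eq_prod (h : IsFull L S) {u : P → U2}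
    (hu : PreservesCode σ (tensorU u)) {v w : P → V} (hv : v ∈ part L S) (hw : w ∈ part L S)
    (hw0 : w ≠ 0) {s t : P} (hs : s ∈ S) (ht : t ∈ S) (hts : t ≠ s) :
    ‖adCoeff (u s) (v s) (w s)‖ =
      ∏ x ∈ Finset.univ.erase s, ‖adCoeff (u x) (v x) (w x)‖ := by
  obtain ⟨hvL, hvS⟩ := mem_part_iff.mp hv
  have hmem {x : P → V} (hx : x ∈ L) (h0 : ∀ q ≠ s, v q = 0 → x q = 0) : x ∈ part L S := by
    refine mem_part_iff.mpr ⟨hx, Function.support_subset_iff'.mpr fun q hq => ?_⟩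
    exact h0 q (ne_of_mem_of_not_mem hs hq).symm (Function.support_subset_iff'.mp hvS q hq)
  refine StabCode.norm_adCoeff_eq_prod (v₀ := ⟨v, hvL⟩) (v₁ := ⟨w, hw.1⟩) hu
    ((h.support_eq hw hw0).ge hs) ?_ ?_
  · intro x _ hx
    exact Subtype.ext (h.eq_of_apply_eq ht (hmem x.2 fun q hq hvq => (hx q hq).trans hvq) hv
      (hx t hts))
  · intro x hxs hx
    exact Subtype.ext (h.eq_of_apply_eq hs (hmem x.2 fun q hq => (hx q hq).mpr) hw hxs)

theorem IsFull.mem_integralRotations (h : IsFull L S) {p q r : P} (hp : p ∈ S) (hq : q ∈ S)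
    (hr : r ∈ S) (hpq : p ≠ q) (hpr : p ≠ r) (hqr : q ≠ r) {g : P → SO3} (hg : g ∈ autGroup σ) :
    g p ∈ integralRotations (Fin 3) := by
  obtain ⟨u, hu, hpres⟩ := hg
  refine mem_integralRotations_of_off_diag fun i j _ => ?_
  obtain ⟨v, hv, hvp⟩ := h.exists_apply_eq hp (axisVec i)
  obtain ⟨w, hw, hwp⟩ := h.exists_apply_eq hp (axisVec j)
  have hv0 : v ≠ 0 := fun hv0 => axisVec_ne_zero i (by rw [← hvp, hv0, Pi.zero_apply])
  have hw0 : w ≠ 0 := fun hw0 => axisVec_ne_zero j (by rw [← hwp, hw0, Pi.zero_apply])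
  have hiff (x : P) : v x = 0 ↔ w x = 0 := by
    rw [← Function.notMem_support, h.support_eq hv hv0, ← h.support_eq hw hw0,
      Function.notMem_support]
  have hprod {s t : P} (hs : s ∈ S) (ht : t ∈ S) (hts : t ≠ s) :=
    h.norm_adCoeff_eq_prod hpres hv hw hw0 hs ht hts
  have hpij : |(g p).1 i j| = 0 ∨ |(g p).1 i j| = 1 := by
    rw [← (hu p).norm_adCoeff, ← hvp, ← hwp]
    exact eq_zero_or_one_of_eq_prod_erase (m := fun x => ‖adCoeff (u x) (v x) (w x)‖)
      (fun _ => norm_nonneg _) (fun x => (hu x).norm_adCoeff_le_one (hiff x)) hpq hpr hqr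
      (hprod hp hq hpq.symm) (hprod hq hp hpq) (hprod hr hp hpr)
  obtain h0 | h1 := hpij
  · exact ⟨0, by simpa using h0⟩
  · obtain h1 | h1 := eq_or_eq_neg_of_abs_eq h1
    · exact ⟨1, by simpa using h1⟩
    · exact ⟨-1, by simpa using h1⟩

theorem apply_mem_axisStab {p : P} {v₀ : P → V} (hv₀ : v₀ ∈ L) {i : Fin 3}
    (hi : v₀ p = axisVec i)
    (huniq : ∀ v ∈ part L (Function.support v₀), v p ≠ 0 → v p = v₀ p) {g : P → SO3}
    (hg : g ∈ autGroup σ) : g p ∈ axisStab i := by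
  obtain ⟨u, hu, hpres⟩ := hg
  have hvp {v : P → V} (hv : v ∈ L) (hp : v p ≠ 0) (h0 : ∀ q ≠ p, v₀ q = 0 → v q = 0) :
      v p = v₀ p := by
    refine huniq v (mem_part_iff.mpr ⟨hv, fun q hq hv₀q => ?_⟩) hp
    obtain rfl | hqp := eq_or_ne q p
    · exact axisVec_ne_zero i (hi.symm.trans hv₀q)
    · exact hq (h0 q hqp hv₀q)
  intro j hj
  have hcoeff : adCoeff (u p) (v₀ p) (axisVec j) = 0 := by
    refine adCoeff_eq_zero_of_isolated (v₀ := ⟨v₀, hv₀⟩) hpres (axisVec_ne_zero j) ?_ ?_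
    · intro v hp hv
      refine Subtype.ext (funext fun q => ?_)
      obtain rfl | hqp := eq_or_ne q p
      · exact hvp v.2 hp fun r hr h0 => (hv r hr).trans h0
      · exact hv q hqp
    · intro v hv
      by_contra! hcon
      have := hvp v.2 (hv.trans_ne (axisVec_ne_zero j)) fun q hq => (hcon q hq).mpr
      exact hj (axisVec_injective (hv.symm.trans (this.trans hi)))
  rw [← abs_eq_zero, ← (hu p).norm_adCoeff, ← hi, hcoeff, norm_zero]

theorem axisStab_or_integralRotations_of_notMem_isGreatest (hL : IsIsotropic L)
    (hzero : ¬SplitsOffZeroFactor L) (hS : IsGreatest {S | IsLagrangianOn L S} S) (σ : Sec L)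
    {p : P} (hp : p ∉ S) :
    (∃ i, ∀ g ∈ autGroup σ, g p ∈ axisStab i) ∨
      ∀ g ∈ autGroup σ, g p ∈ integralRotations (Fin 3) := by
  obtain ⟨v₀, hv₀, h₀, hmin⟩ := exists_minimal_support hzero p
  by_cases huniq : ∀ v ∈ part L (Function.support v₀), v p ≠ 0 → v p = v₀ p
  · obtain ⟨i, hi⟩ := exists_axisVec_eq h₀
    exact Or.inl ⟨i, fun g hg => apply_mem_axisStab hv₀ hi.symm huniq hg⟩
  push Not at huniq
  obtain ⟨v₁, hv₁, h₁, hne⟩ := huniq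
  have hfull := isFull_support hv₀ h₀ hmin hv₁ h₁ hne.symm
  obtain ⟨q, hq, hqp⟩ := hfull.exists_ne hL h₀
  obtain ⟨r, hr, hrp, hrq⟩ : ∃ r ∈ Function.support v₀, r ≠ p ∧ r ≠ q := by
    by_contra! hpair
    have hsupp : Function.support v₀ = {p, q} := by
      refine Set.Subset.antisymm (fun r hr => ?_) (Set.insert_subset h₀ (by simpa using hq))
      exact or_iff_not_imp_left.mpr (hpair r hr)
    exact hp (hS.2 ((hsupp ▸ hfull).isLagrangianOn_pair hL) (Set.mem_insert p {q}))
  exact Or.inr fun g hg => hfull.mem_integralRotations h₀ hq hr hqp.symm hrp.symm hrq.symm hg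

end

end LocalTypes

section LagrangianSubsystem

open Matrix

variable {P : Type*} [Fintype P] [DecidableEq P] {L : Submodule (ZMod 2) (P → V)} {S : Set P}

theorem stabSum_mul_stabMat (σ : Sec L) (v : L) : stabSum σ * stabMat σ v = stabSum σ := by
  simpa only [star_mul, star_stabSum, star_stabMat] using congrArg star (stabMat_mul_stabSum σ v)

theorem stabSum_mulVec_of_mem_code {σ : Sec L} {ψ : StateSpace P} (hψ : ψ ∈ code σ) :
    stabSum σ *ᵥ ψ.ofLp = (Fintype.card L : ℂ) • ψ.ofLp := by
  rw [stabSum, sum_mulVec, Finset.sum_congr rfl fun v _ => (mem_code_iff σ).mp hψ v,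
    Finset.sum_const, Finset.card_univ, Nat.cast_smul_eq_nsmul]

theorem stabSum_mulVec_pauliTensor_mulVec_eq_zero {σ : Sec L} {v : L} {w : P → V}
    (h : omega v.1 w ≠ 0) {ψ : StateSpace P} (hψ : ψ ∈ code σ) :
    stabSum σ *ᵥ (pauliTensor w *ᵥ ψ.ofLp) = 0 := by
  have hanti : stabMat σ v * pauliTensor w = -(pauliTensor w * stabMat σ v) := by
    have hne_zero : ∀ x : ZMod 2, x ≠ 0 → x = 1 := by decide
    rw [stabMat_eq, smul_mul_assoc, pauliTensor_mul_comm, hne_zero _ h, sgn_one, neg_one_smul,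
      smul_neg, mul_smul_comm]
  refine self_eq_neg.mp ?_
  calc stabSum σ *ᵥ (pauliTensor w *ᵥ ψ.ofLp)
      = stabSum σ *ᵥ ((stabMat σ v * pauliTensor w) *ᵥ ψ.ofLp) := by
        rw [mulVec_mulVec, mulVec_mulVec, ← mul_assoc, stabSum_mul_stabMat]
    _ = -(stabSum σ *ᵥ (pauliTensor w *ᵥ ψ.ofLp)) := by
        rw [hanti, neg_mulVec, mulVec_neg, ← mulVec_mulVec, (mem_code_iff σ).mp hψ v]

namespace IsLagrangianOn

variable {τ : Sec (part L S)}

theorem exists_stabSum_mulVec_pauliTensor_mulVec (h : IsLagrangianOn L S) (τ : Sec (part L S))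
    {w : P → V} (hw : w ∈ supportedOn S) :
    ∃ c : ℂ, ∀ ψ ∈ code τ, stabSum τ *ᵥ (pauliTensor w *ᵥ ψ.ofLp) = c • ψ.ofLp := by
  by_cases horth : ∀ v ∈ part L S, omega v w = 0
  · let v : part L S := ⟨w, h w hw horth, hw⟩
    refine ⟨(stabPhase τ v)⁻¹ * Fintype.card (part L S), fun ψ hψ => ?_⟩
    have hψ' : pauliTensor w *ᵥ ψ.ofLp = (stabPhase τ v)⁻¹ • ψ.ofLp := by
      rw [eq_inv_smul_iff₀ (stabPhase_ne_zero τ v), ← smul_mulVec]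
      exact (congrArg (· *ᵥ ψ.ofLp) (stabMat_eq τ v)).symm.trans ((mem_code_iff τ).mp hψ v)
    rw [hψ', mulVec_smul, stabSum_mulVec_of_mem_code hψ, smul_smul]
  · push Not at horth
    obtain ⟨v, hv, hne⟩ := horth
    refine ⟨0, fun ψ hψ => ?_⟩
    rw [zero_smul, stabSum_mulVec_pauliTensor_mulVec_eq_zero (v := ⟨v, hv⟩) hne hψ]

theorem exists_stabSum_mulVec_tensorMat_mulVec (h : IsLagrangianOn L S) (τ : Sec (part L S))
    {M : P → Matrix (Fin 2) (Fin 2) ℂ} (hM : ∀ p ∉ S, M p = 1) :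
    ∃ c : ℂ, ∀ ψ ∈ code τ, stabSum τ *ᵥ (tensorMat M *ᵥ ψ.ofLp) = c • ψ.ofLp := by
  have hterm (w : P → V) : ∃ c : ℂ, ∀ ψ ∈ code τ,
      stabSum τ *ᵥ (((∏ p, pauliCoeff (M p) (w p)) • pauliTensor w) *ᵥ ψ.ofLp) = c • ψ.ofLp := by
    by_cases hw : w ∈ supportedOn S
    · obtain ⟨c, hc⟩ := h.exists_stabSum_mulVec_pauliTensor_mulVec τ hw
      refine ⟨(∏ p, pauliCoeff (M p) (w p)) * c, fun ψ hψ => ?_⟩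
      rw [smul_mulVec, mulVec_smul, hc ψ hψ, smul_smul]
    · obtain ⟨p, hp, hwp⟩ : ∃ p ∉ S, w p ≠ 0 := by
        by_contra! hcon
        exact hw hcon
      refine ⟨0, fun ψ _ => ?_⟩
      rw [Finset.prod_eq_zero (Finset.mem_univ p)
        (by rw [hM p hp, pauliCoeff_one, if_neg hwp]), zero_smul, zero_smul, zero_mulVec,
        mulVec_zero]
  choose c hc using hterm
  refine ⟨∑ w, c w, fun ψ hψ => ?_⟩
  rw [tensorMat_eq_sum_pauliTensor, sum_mulVec, mulVec_sum, Finset.sum_smul]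
  exact Finset.sum_congr rfl fun w _ => hc w ψ hψ

theorem exists_act_tensorU_eq_smul (h : IsLagrangianOn L S) (τ : Sec (part L S)) {u : P → U2}
    (hu : ∀ p ∉ S, u p = 1) :
    ∃ c : ℂ, ∀ ψ ∈ code τ, act (tensorU u) ψ ∈ code τ → act (tensorU u) ψ = c • ψ := by
  obtain ⟨c, hc⟩ := h.exists_stabSum_mulVec_tensorMat_mulVec τ (M := fun p => (u p).1)
    fun p hp => by rw [hu p hp]; rfl
  refine ⟨(Fintype.card (part L S) : ℂ)⁻¹ * c, fun ψ hψ hu => WithLp.ofLp_injective 2 ?_⟩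
  have hsum := stabSum_mulVec_of_mem_code hu
  rw [ofLp_act] at hsum ⊢
  rw [WithLp.ofLp_smul, mul_smul,
    eq_inv_smul_iff₀ (Nat.cast_ne_zero.mpr Fintype.card_ne_zero), ← hc ψ hψ, ← hsum]
  rfl

end IsLagrangianOn

theorem preservesCode_of_forall_eq_zero_or_eq_one {σ : Sec L} {u : P → U2}
    (hu : ∀ v ∈ L, ∀ p, v p = 0 ∨ u p = 1) : PreservesCode σ (tensorU u) := by
  refine fun ψ hψ => (mem_code_iff σ).mpr fun v => ?_
  have hcomm : stabMat σ v * (tensorU u).1 = (tensorU u).1 * stabMat σ v := by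
    rw [stabMat_eq, smul_mul_assoc, mul_smul_comm, coe_tensorU, pauliTensor, ← tensorMat_mul,
      ← tensorMat_mul]
    congr 2
    funext p
    obtain h0 | h1 := hu v.1 v.2 p
    · rw [Pi.mul_apply, Pi.mul_apply, h0, pauliOf_zero, one_mul, mul_one]
    · rw [Pi.mul_apply, Pi.mul_apply, h1, OneMemClass.coe_one, one_mul, mul_one]
  rw [ofLp_act, mulVec_mulVec, hcomm, ← mulVec_mulVec, (mem_code_iff σ).mp hψ v]

/-- The restriction of a section to a subspace. -/
def Sec.restrict {L' : Submodule (ZMod 2) (P → V)} (σ : Sec L) (h : L' ≤ L) : Sec L' where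
  hom := σ.hom.comp (Submodule.inclusion h).toAddMonoidHom.toMultiplicative
  liesOver v := σ.liesOver (Submodule.inclusion h v)

theorem Sec.code_le_code_restrict {L' : Submodule (ZMod 2) (P → V)} (σ : Sec L) (h : L' ≤ L) :
    code σ ≤ code (σ.restrict h) :=
  fun _ hψ v => hψ (Submodule.inclusion h v)

namespace IsLagrangianOn

variable {σ : Sec L}

theorem exists_act_tensorU_mulIndicator_compl_eq_smul (h : IsLagrangianOn L S) {u : P → U2}
    (hu : PreservesCode σ (tensorU u)) :
    ∃ c : ℂ, ∀ ψ ∈ code σ, act (tensorU (Sᶜ.mulIndicator u)) ψ = c • act (tensorU u) ψ := by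
  have hle : part L S ≤ L := inf_le_left
  obtain ⟨c, hc⟩ := h.exists_act_tensorU_eq_smul (σ.restrict hle) (u := (S.mulIndicator u)⁻¹)
    fun p hp => by rw [Pi.inv_apply, Set.mulIndicator_of_notMem hp, inv_one]
  have hsplit (ψ : StateSpace P) : act (tensorU (Sᶜ.mulIndicator u)) ψ =
      act (tensorU (S.mulIndicator u)⁻¹) (act (tensorU u) ψ) := by
    rw [← LinearMap.comp_apply, ← act_mul, ← map_mul,
      inv_mul_eq_iff_eq_mul.mpr (Set.mulIndicator_self_mul_compl S u).symm]
  have hout : PreservesCode (σ.restrict hle) (tensorU (Sᶜ.mulIndicator u)) := by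
    refine preservesCode_of_forall_eq_zero_or_eq_one fun v hv p => ?_
    by_cases hp : p ∈ S
    · exact Or.inr (Set.mulIndicator_of_notMem (Set.notMem_compl_iff.mpr hp) u)
    · exact Or.inl (hv.2 p hp)
  refine ⟨c, fun ψ hψ => ?_⟩
  rw [hsplit]
  refine hc _ (σ.code_le_code_restrict hle (hu ψ hψ)) ?_
  rw [← hsplit]
  exact hout ψ (σ.code_le_code_restrict hle hψ)

theorem exists_mk_eq_mk_mulIndicator_compl (h : IsLagrangianOn L S) (g : autGroup σ) :
    ∃ g' : autGroup σ, g'.1 = Sᶜ.mulIndicator g.1 ∧ (g' : LogicalGroup σ) = g := by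
  obtain ⟨u, hu, hpres⟩ := g.2
  obtain ⟨c, hc⟩ := h.exists_act_tensorU_mulIndicator_compl_eq_smul hpres
  have hrep (p : P) : Represents (Sᶜ.mulIndicator u p) (Sᶜ.mulIndicator g.1 p) := by
    by_cases hp : p ∈ Sᶜ
    · simpa only [Set.mulIndicator_of_mem hp] using hu p
    · simpa only [Set.mulIndicator_of_notMem hp] using Represents.one
  have hpres' : PreservesCode σ (tensorU (Sᶜ.mulIndicator u)) := fun ψ hψ => by
    rw [hc ψ hψ]
    exact (code σ).smul_mem c (hpres ψ hψ)
  refine ⟨⟨Sᶜ.mulIndicator g.1, Sᶜ.mulIndicator u, hrep, hpres'⟩, rfl, ?_⟩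
  refine Eq.symm (QuotientGroup.eq.mpr ?_)
  refine ⟨u⁻¹ * Sᶜ.mulIndicator u, fun p => (hu p).inv.mul (hrep p), c, fun ψ hψ => ?_⟩
  rw [map_mul, map_inv, act_mul, LinearMap.comp_apply, hc ψ hψ, map_smul, act_inv_act]

end IsLagrangianOn

end LagrangianSubsystem

section LocalReduction

open Filter Topology Multiplicative

instance isSolvable_pi {ι : Type*} [Finite ι] {H : ι → Type*} [∀ i, Group (H i)]
    [∀ i, Group.IsSolvable (H i)] : Group.IsSolvable (∀ i, H i) := by
  have := Fintype.ofFinite ι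
  choose n hn using fun i => (inferInstance : Group.IsSolvable (H i)).solvable
  refine ⟨⟨∑ i, n i, (Subgroup.eq_bot_iff_forall _).mpr fun x hx => funext fun i => ?_⟩⟩
  have hxi : x i ∈ derivedSeries (H i) (∑ i, n i) :=
    map_derivedSeries_le_derivedSeries (Pi.evalMonoidHom H i) _ (Subgroup.mem_map_of_mem _ hx)
  have hle : derivedSeries (H i) (∑ i, n i) ≤ derivedSeries (H i) (n i) :=
    derivedSeries_antitone _ (Finset.single_le_sum (fun _ _ => Nat.zero_le _) (Finset.mem_univ i))
  exact Subgroup.mem_bot.mp (hn i ▸ hle hxi)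

/-- Near the identity, the subgroup `H` is contained in the image of arbitrarily small parameters
of a one-parameter group, which is allowed to be trivial. -/
def IsLocallyOneParameter {G : Type*} [Group G] [TopologicalSpace G] (H : Subgroup G) : Prop :=
  ∃ ρ : Multiplicative ℝ →* G, Continuous ρ ∧
    ∀ ε > 0, ∀ᶠ g in 𝓝 1, g ∈ H → ∃ θ : ℝ, |θ| < ε ∧ ρ (ofAdd θ) = g

theorem isLocallyOneParameter_of_eventually_eq_one {G : Type*} [Group G] [TopologicalSpace G]
    {H : Subgroup G} (h : ∀ᶠ g in 𝓝 1, g ∈ H → g = 1) : IsLocallyOneParameter H :=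
  ⟨1, continuous_const, fun ε hε => h.mono fun _ hg hgH => ⟨0, by simpa using hε, (hg hgH).symm⟩⟩

theorem isLocallyOneParameter_axisStab (i : Fin 3) :
    IsLocallyOneParameter (axisStab i : Subgroup SO3) := by
  let ρ : Multiplicative ℝ →* SO3 :=
    { toFun θ := rot i (toAdd θ)
      map_one' := rot_zero i
      map_mul' _ _ := rot_add i _ _ }
  refine ⟨ρ, (continuous_rot i).comp continuous_toAdd, fun ε hε => ?_⟩
  filter_upwards [eventually_eq_rot_of_mem_axisStab i hε] with g hg hgi
  obtain ⟨θ, hθ, hgθ⟩ := hg hgi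
  exact ⟨θ, hθ, hgθ.symm⟩

variable {P : Type*} [Fintype P] [DecidableEq P] {L : Submodule (ZMod 2) (P → V)} {σ : Sec L}
  {H : P → Subgroup SO3}

/-- Every logical operator has a representative with components in the groups `H p`, which arises
from a given representative by replacing some components by the identity. -/
def IsReduction (σ : Sec L) (H : P → Subgroup SO3) : Prop :=
  ∀ g : autGroup σ, ∃ g' : autGroup σ, (∀ p, g'.1 p ∈ H p) ∧ (∀ p, g'.1 p = 1 ∨ g'.1 p = g.1 p) ∧
    (g' : LogicalGroup σ) = g

theorem exists_isReduction (hL : IsIsotropic L) (hzero : ¬SplitsOffZeroFactor L) (σ : Sec L) :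
    ∃ H : P → Subgroup SO3, (∀ p, Group.IsSolvable (H p)) ∧ (∀ p, IsLocallyOneParameter (H p)) ∧
      IsReduction σ H := by
  obtain ⟨S, hS⟩ := exists_isGreatest_isLagrangianOn hL
  have hlocal (p : P) : ∃ H : Subgroup SO3, Group.IsSolvable H ∧ IsLocallyOneParameter H ∧
      (p ∉ S → ∀ g ∈ autGroup σ, g p ∈ H) := by
    by_cases hp : p ∈ S
    · refine ⟨⊥, inferInstance, isLocallyOneParameter_of_eventually_eq_one ?_, absurd hp⟩
      exact Eventually.of_forall fun _ => Subgroup.mem_bot.mp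
    rcases axisStab_or_integralRotations_of_notMem_isGreatest hL hzero hS σ hp with ⟨i, hi⟩ | hintegral
    · exact ⟨axisStab i, inferInstance, isLocallyOneParameter_axisStab i, fun _ => hi⟩
    · refine ⟨integralRotations (Fin 3), inferInstance, ?_, fun _ => hintegral⟩
      exact isLocallyOneParameter_of_eventually_eq_one eventually_eq_one_of_mem_integralRotations
  choose H hsolv hone hmem using hlocal
  refine ⟨H, hsolv, hone, fun g => ?_⟩
  obtain ⟨g', hg', hmk⟩ := hS.1.exists_mk_eq_mk_mulIndicator_compl g
  refine ⟨g', fun p => ?_, fun p => ?_, hmk⟩ <;> rw [hg'] <;> by_cases hp : p ∈ Sᶜ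
  · rw [Set.mulIndicator_of_mem hp]
    exact hmem p hp g.1 g.2
  · rw [Set.mulIndicator_of_notMem hp]
    exact one_mem _
  · exact Or.inr (Set.mulIndicator_of_mem hp _)
  · exact Or.inl (Set.mulIndicator_of_notMem hp _)

theorem IsReduction.isSolvable_logicalGroup [∀ p, Group.IsSolvable (H p)] (h : IsReduction σ H) :
    Group.IsSolvable (LogicalGroup σ) := by
  let B : Subgroup (autGroup σ) := (Subgroup.pi Set.univ H).subgroupOf (autGroup σ)
  let f : B →* ∀ p, H p :=
    { toFun g p := ⟨g.1.1 p, g.2 p (Set.mem_univ p)⟩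
      map_one' := rfl
      map_mul' _ _ := rfl }
  have hf : Function.Injective f := fun g h hgh =>
    Subtype.ext (Subtype.ext (funext fun p => congrArg Subtype.val (congrFun hgh p)))
  have : Group.IsSolvable B := Group.isSolvable_of_isSolvable_injective hf
  refine Group.isSolvable_of_surjective
    (f := (QuotientGroup.mk' (scalarGroup σ)).comp B.subtype) fun x => ?_
  obtain ⟨g, rfl⟩ := QuotientGroup.mk_surjective x
  obtain ⟨g', hg'H, -, hmk⟩ := h g
  exact ⟨⟨g', fun p _ => hg'H p⟩, hmk⟩

theorem isSolvable_logicalGroup (hL : IsIsotropic L) (hzero : ¬SplitsOffZeroFactor L)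
    (σ : Sec L) : Group.IsSolvable (LogicalGroup σ) := by
  obtain ⟨H, _, -, hred⟩ := exists_isReduction hL hzero σ
  exact hred.isSolvable_logicalGroup

end LocalReduction

section Compactness

open Matrix Topology

theorem isClosed_represents {P : Type*} :
    IsClosed {x : (P → U2) × (P → SO3) | ∀ p, Represents (x.1 p) (x.2 p)} := by
  simp only [Represents, Set.ofPred_forall]
  refine isClosed_iInter fun p => isClosed_iInter fun j => isClosed_eq ?_ ?_
  · have hu : Continuous fun x : (P → U2) × (P → SO3) => (x.1 p).1 := by fun_prop
    exact (hu.mul continuous_const).mul hu.star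
  · refine continuous_finsetSum _ fun i _ => ?_
    have hg : Continuous fun x : (P → U2) × (P → SO3) => ((x.2 p).1 i j : ℂ) :=
      Complex.continuous_ofReal.comp
        ((continuous_entry i j).comp ((continuous_apply p).comp continuous_snd))
    exact hg.smul continuous_const

variable {P : Type*} [Fintype P] [DecidableEq P]

theorem continuous_act (ψ : StateSpace P) : Continuous fun U : UnitaryOn P => act U ψ :=
  (PiLp.continuous_toLp 2 _).comp
    (Continuous.matrix_mulVec continuous_subtype_val continuous_const)

theorem continuous_tensorU : Continuous (tensorU : (P → U2) →* UnitaryOn P) := by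
  refine Continuous.subtype_mk (continuous_matrix fun a b => ?_) _
  exact continuous_finsetProd _ fun p _ =>
    (continuous_subtype_val.comp (continuous_apply p)).matrix_elem _ _

theorem continuous_act_tensorU (ψ : StateSpace P) :
    Continuous fun u : P → U2 => act (tensorU u) ψ :=
  (continuous_act ψ).comp continuous_tensorU

theorem exists_forall_eq_smul_iff {ι : Type*} {U : EuclideanSpace ℂ ι →ₗ[ℂ] EuclideanSpace ℂ ι}
    {C : Submodule ℂ (EuclideanSpace ℂ ι)} :
    (∃ c : ℂ, ∀ ψ ∈ C, U ψ = c • ψ) ↔ ∀ ψ ∈ C, ∀ χ ∈ C, ∀ a b, U ψ a * χ b = ψ a * U χ b := by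
  constructor
  · rintro ⟨c, hc⟩ ψ hψ χ hχ a b
    rw [hc ψ hψ, hc χ hχ, PiLp.smul_apply, PiLp.smul_apply, smul_eq_mul, smul_eq_mul]
    ring
  · intro h
    by_cases hbot : C = ⊥
    · exact ⟨0, by simp [hbot]⟩
    obtain ⟨χ, hχ, hne⟩ := C.ne_bot_iff.mp hbot
    obtain ⟨b, hb⟩ : ∃ b, χ b ≠ 0 := by
      by_contra! hχ0
      exact hne (PiLp.ext hχ0)
    refine ⟨U χ b / χ b, fun ψ hψ => PiLp.ext fun a => ?_⟩
    rw [PiLp.smul_apply, smul_eq_mul]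
    field_simp
    linear_combination h ψ hψ χ hχ a b

variable {L : Submodule (ZMod 2) (P → V)} (σ : Sec L)

theorem isClosed_autGroup : IsClosed (autGroup σ : Set (P → SO3)) := by
  have hpres : IsClosed {x : (P → U2) × (P → SO3) |
      ∀ ψ ∈ code σ, act (tensorU x.1) ψ ∈ code σ} := by
    simp only [Set.ofPred_forall]
    exact isClosed_iInter fun ψ => isClosed_iInter fun _ =>
      (code σ).closed_of_finiteDimensional.preimage
        ((continuous_act_tensorU ψ).comp continuous_fst)
  convert isClosedMap_snd_of_compactSpace _ (isClosed_represents.inter hpres) using 1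
  ext g
  exact ⟨fun ⟨u, hu⟩ => ⟨(u, g), hu, rfl⟩, fun ⟨x, hx, hxg⟩ => hxg ▸ ⟨x.1, hx⟩⟩

theorem isClosed_scalarGroup : IsClosed (scalarGroup σ : Set (autGroup σ)) := by
  have hscalar : IsClosed {x : (P → U2) × (P → SO3) |
      ∃ c : ℂ, ∀ ψ ∈ code σ, act (tensorU x.1) ψ = c • ψ} := by
    have hcont (ψ : StateSpace P) (a : P → Fin 2) :
        Continuous fun x : (P → U2) × (P → SO3) => act (tensorU x.1) ψ a :=
      (PiLp.continuous_apply 2 _ a).comp ((continuous_act_tensorU ψ).comp continuous_fst)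
    simp only [exists_forall_eq_smul_iff, Set.ofPred_forall]
    exact isClosed_iInter fun ψ => isClosed_iInter fun _ => isClosed_iInter fun χ =>
      isClosed_iInter fun _ => isClosed_iInter fun a => isClosed_iInter fun b =>
        isClosed_eq ((hcont ψ a).mul continuous_const) (continuous_const.mul (hcont χ b))
  have himage := isClosedMap_snd_of_compactSpace _ (isClosed_represents.inter hscalar)
  convert himage.preimage (continuous_subtype_val (p := fun g => g ∈ autGroup σ)) using 1
  ext g
  exact ⟨fun ⟨u, hu⟩ => ⟨(u, g.1), hu, rfl⟩, fun ⟨x, hx, hxg⟩ => ⟨x.1, hxg ▸ hx⟩⟩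

instance compactSpace_autGroup : CompactSpace (autGroup σ) :=
  isCompact_iff_compactSpace.mp (isClosed_autGroup σ).isCompact

instance t2Space_logicalGroup : T2Space (LogicalGroup σ) := by
  have := isClosed_scalarGroup σ
  infer_instance

end Compactness

section LieStructure

open Topology Filter Multiplicative

variable {P : Type*} [Fintype P] [DecidableEq P] {L : Submodule (ZMod 2) (P → V)} {σ : Sec L}

theorem IsReduction.exists_lieGroup_logicalGroup {H : P → Subgroup SO3} (h : IsReduction σ H)
    (hH : ∀ p, IsLocallyOneParameter (H p)) :
    ∃ (n : ℕ) (_ : ChartedSpace (EuclideanSpace ℝ (Fin n)) (LogicalGroup σ)),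
      LieGroup (𝓡 n) ∞ (LogicalGroup σ) := by
  choose ρ hρ hsmall using hH
  let torus : Multiplicative (P → ℝ) →* (P → SO3) :=
    { toFun θ p := ρ p (ofAdd (toAdd θ p))
      map_one' := funext fun p => map_one (ρ p)
      map_mul' _ _ := funext fun p => map_mul (ρ p) _ _ }
  have htorus : Continuous torus := continuous_pi fun p =>
    (hρ p).comp (continuous_ofAdd.comp ((continuous_apply p).comp continuous_toAdd))
  refine exists_lieGroup_of_eventually_mem_image (isClosed_autGroup σ)
    (π := QuotientGroup.mk' (scalarGroup σ)) QuotientGroup.continuous_mk htorus fun ε hε => ?_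
  have hnear : ∀ᶠ g : autGroup σ in 𝓝 1, ∀ p,
      g.1 p ∈ H p → ∃ θ : ℝ, |θ| < ε ∧ ρ p (ofAdd θ) = g.1 p := by
    refine eventually_all.mpr fun p => ?_
    have hcont : Continuous fun g : autGroup σ => g.1 p :=
      (continuous_apply p).comp continuous_subtype_val
    exact (hcont.tendsto' 1 1 rfl).eventually (hsmall p ε hε)
  filter_upwards [(QuotientGroup.isOpenMap_coe (N := scalarGroup σ)).image_mem_nhds hnear]
  rintro _ ⟨g, hg, rfl⟩
  obtain ⟨g', hg'H, hg', hmk⟩ := h g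
  have hangle (p : P) : ∃ θ : ℝ, |θ| < ε ∧ ρ p (ofAdd θ) = g'.1 p := by
    rcases hg' p with hp | hp
    · exact ⟨0, by simpa using hε, by rw [hp, ofAdd_zero, map_one]⟩
    · rw [hp]
      exact hg p (hp ▸ hg'H p)
  choose θ hθ hθg using hangle
  have htorusθ : torus (ofAdd θ) = g'.1 := funext hθg
  exact ⟨θ, htorusθ ▸ g'.2, (pi_norm_lt_iff hε).mpr hθ,
    (congrArg QuotientGroup.mk (Subtype.ext htorusθ)).trans hmk⟩

theorem isCompactLieGroup_logicalGroup (hL : IsIsotropic L) (hzero : ¬SplitsOffZeroFactor L)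
    (σ : Sec L) : IsCompactLieGroup (LogicalGroup σ) := by
  have : SecondCountableTopology (autGroup σ) :=
    Topology.IsEmbedding.subtypeVal.secondCountableTopology
  obtain ⟨H, -, hH, hred⟩ := exists_isReduction hL hzero σ
  exact ⟨inferInstance, inferInstance, inferInstance, hred.exists_lieGroup_logicalGroup hH⟩

end LieStructure

section NotSolvable

open Matrix ComplexConjugate commutatorElement Real

theorem circle_mul_conj (z : Circle) : (z : ℂ) * conj (z : ℂ) = 1 := by
  rw [Complex.mul_conj, Circle.normSq_coe, Complex.ofReal_one]

/-- The rotation about the `Z` axis with eigenvalues `z` and `z⁻¹`. -/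
def diagTurn (z : Circle) : U2 :=
  ⟨!![(z : ℂ), 0; 0, conj (z : ℂ)], by
    rw [mem_unitaryGroup_iff, star_eq_conjTranspose]
    ext a b
    fin_cases a <;> fin_cases b <;>
      simp [Matrix.mul_apply, circle_mul_conj, mul_comm (conj (z : ℂ))]⟩

/-- The rotation by a half turn about an axis orthogonal to the `Z` axis. -/
def halfTurn (z : Circle) : U2 :=
  ⟨!![0, (z : ℂ); -conj (z : ℂ), 0], by
    rw [mem_unitaryGroup_iff, star_eq_conjTranspose]
    ext a b
    fin_cases a <;> fin_cases b <;>
      simp [Matrix.mul_apply, circle_mul_conj, mul_comm (conj (z : ℂ))]⟩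

theorem commutatorElement_halfTurn_halfTurn_one (z : Circle) :
    ⁅halfTurn z, halfTurn 1⁆ = diagTurn (z ^ 2) := by
  rw [commutatorElement_def, mul_inv_eq_iff_eq_mul, mul_inv_eq_iff_eq_mul]
  apply Subtype.ext
  ext a b
  fin_cases a <;> fin_cases b <;> simp [halfTurn, diagTurn]
  · linear_combination -(z : ℂ) * circle_mul_conj z
  · linear_combination -conj (z : ℂ) * circle_mul_conj z

theorem exists_conj_diagTurn_eq_halfTurn (z : Circle) :
    ∃ h : U2, h * diagTurn (Circle.exp (π / 2)) * h⁻¹ = halfTurn z := by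
  obtain ⟨s, hs, hss⟩ : ∃ s : ℂ, conj s = s ∧ s * s = 1 / 2 := by
    refine ⟨(√(1 / 2) : ℝ), Complex.conj_ofReal _, ?_⟩
    rw [← Complex.ofReal_mul, Real.mul_self_sqrt (by norm_num)]
    norm_num
  have hz := circle_mul_conj z
  have hI := Complex.I_mul_I
  let h : Matrix (Fin 2) (Fin 2) ℂ :=
    !![s, s; s * (Complex.I * conj (z : ℂ)), -(s * (Complex.I * conj (z : ℂ)))]
  have hh : h ∈ unitaryGroup (Fin 2) ℂ := by
    rw [mem_unitaryGroup_iff, star_eq_conjTranspose]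
    ext a b
    fin_cases a <;> fin_cases b <;> simp [h, Matrix.mul_apply, hs]
    · linear_combination 2 * hss
    · linear_combination (-2 * s * s * conj (z : ℂ) * z) * hI + 2 * hss + 2 * s * s * hz
  refine ⟨⟨h, hh⟩, mul_inv_eq_iff_eq_mul.mpr (Subtype.ext ?_)⟩
  ext a b
  fin_cases a <;> fin_cases b <;> simp [h, diagTurn, halfTurn]
  · linear_combination (-s * Complex.I) * hz
  · linear_combination (-s * Complex.I) * hz
  · linear_combination (s * conj (z : ℂ)) * hI
  · linear_combination (s * conj (z : ℂ)) * hI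

theorem diagTurn_mem_derivedSeries (n : ℕ) :
    diagTurn (Circle.exp (π / 2)) ∈ derivedSeries U2 n := by
  induction n with
  | zero => exact Subgroup.mem_top _
  | succ n ih =>
    have hhalfTurn (z : Circle) : halfTurn z ∈ derivedSeries U2 n := by
      obtain ⟨h, hh⟩ := exists_conj_diagTurn_eq_halfTurn z
      exact hh ▸ (derivedSeries_normal U2 n).conj_mem _ ih h
    have hsq : Circle.exp (π / 2) = Circle.exp (π / 4) ^ 2 := by
      rw [← Circle.exp_nsmul]
      congr 1
      ring
    rw [derivedSeries_succ, hsq, ← commutatorElement_halfTurn_halfTurn_one]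
    exact Subgroup.commutator_mem_commutator (hhalfTurn _) (hhalfTurn 1)

theorem not_isSolvable_U2 : ¬Group.IsSolvable U2 := by
  refine not_isSolvable_of_mem_derivedSeries (fun h => ?_) diagTurn_mem_derivedSeries
  have hI : Complex.I = 1 := by
    simpa [diagTurn] using congr(($h).1 0 0)
  simpa using congrArg Complex.im hI

theorem isSolvable_of_map_ker_le_center {D G H : Type*} [Group D] [Group G] [Group H]
    [Group.IsSolvable H] {f : D →* G} (hf : Function.Surjective f) {g : D →* H}
    (hker : g.ker.map f ≤ Subgroup.center G) : Group.IsSolvable G := by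
  obtain ⟨n, hn⟩ := (inferInstance : Group.IsSolvable H).solvable
  have hD : derivedSeries D n ≤ g.ker := fun x hx => by
    rw [MonoidHom.mem_ker, ← Subgroup.mem_bot, ← hn]
    exact map_derivedSeries_le_derivedSeries g n (Subgroup.mem_map_of_mem g hx)
  have hG : derivedSeries G n ≤ Subgroup.center G :=
    (derivedSeries_le_map_derivedSeries hf n).trans ((Subgroup.map_mono hD).trans hker)
  refine ⟨n + 1, ?_⟩
  rw [derivedSeries_succ, Subgroup.commutator_eq_bot_iff_le_centralizer]
  exact hG.trans (Subgroup.center_le_centralizer _)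

end NotSolvable

section Phases

open Matrix

variable {P : Type*} [Fintype P] [DecidableEq P]

theorem coe_eq_smul_one_iff {U : UnitaryOn P} {c : ℂ} :
    U.1 = c • 1 ↔ ∀ χ, act U χ = c • χ := by
  constructor
  · intro hU χ
    apply WithLp.ofLp_injective 2
    rw [ofLp_act, hU, smul_mulVec, one_mulVec, WithLp.ofLp_smul]
  · intro hU
    rw [Matrix.ext_iff_mulVec]
    intro χ
    rw [smul_mulVec, one_mulVec]
    exact congrArg WithLp.ofLp (hU (WithLp.toLp 2 χ))

theorem exists_circle_of_coe_eq_smul_one {n : Type*} [Fintype n] [DecidableEq n] [Nonempty n]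
    {U : Matrix.unitaryGroup n ℂ} {c : ℂ} (hU : U.1 = c • 1) : ∃ z : Circle, (z : ℂ) = c := by
  have hunit : star U.1 * U.1 = 1 := Matrix.mem_unitaryGroup_iff'.mp U.2
  obtain ⟨i⟩ := ‹Nonempty n›
  have hc : c * (starRingEnd ℂ) c = 1 := by simpa [hU] using congr($hunit i i)
  rw [Complex.mul_conj, ← Complex.ofReal_one, Complex.ofReal_inj, Complex.normSq_eq_norm_sq,
    pow_eq_one_iff_of_nonneg (norm_nonneg c) two_ne_zero] at hc
  exact ⟨⟨c, mem_sphere_zero_iff_norm.mpr hc⟩, rfl⟩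

theorem act_act_inv (U : UnitaryOn P) (ψ : StateSpace P) : act U (act U⁻¹ ψ) = ψ := by
  simpa only [inv_inv] using act_inv_act U⁻¹ ψ

end Phases

section Realization

open Matrix Topology

variable {P : Type*} [Fintype P] [DecidableEq P] {L : Submodule (ZMod 2) (P → V)} {σ : Sec L}
  {d : ℕ} {φ : code σ ≃ₗ[ℂ] StateSpace (Fin d)} {u w : P → U2} {U W : UnitaryOn (Fin d)}

variable (φ) in
/-- The local unitary operator given by `u` realises the logical operator `W` up to a phase. -/
def Realizes (u : P → U2) (W : UnitaryOn (Fin d)) : Prop :=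
  ∃ c : Circle, ∀ ψ : code σ,
    act (tensorU u) (ψ : StateSpace P) = (c : ℂ) • (φ.symm (act W (φ ψ)) : StateSpace P)

namespace Realizes

theorem of_coe_eq_smul_one {c : ℂ} (hW : W.1 = c • 1) : Realizes φ 1 W := by
  obtain ⟨z, rfl⟩ := exists_circle_of_coe_eq_smul_one hW
  refine ⟨z⁻¹, fun ψ => ?_⟩
  rw [map_one, act_one, coe_eq_smul_one_iff.mp hW, map_smul, LinearEquiv.symm_apply_apply,
    Submodule.coe_smul, smul_smul, ← Circle.coe_mul, inv_mul_cancel, Circle.coe_one, one_smul,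
    LinearMap.id_apply]

theorem one : Realizes φ 1 1 := of_coe_eq_smul_one (one_smul ℂ _).symm

theorem mul (hu : Realizes φ u U) (hw : Realizes φ w W) : Realizes φ (u * w) (U * W) := by
  obtain ⟨c, hc⟩ := hu
  obtain ⟨e, he⟩ := hw
  refine ⟨e * c, fun ψ => ?_⟩
  rw [map_mul, act_mul, LinearMap.comp_apply, he, map_smul, hc, smul_smul, Circle.coe_mul,
    act_mul, LinearEquiv.apply_symm_apply, LinearMap.comp_apply]

theorem inv (hu : Realizes φ u W) : Realizes φ u⁻¹ W⁻¹ := by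
  obtain ⟨c, hc⟩ := hu
  refine ⟨c⁻¹, fun ψ => ?_⟩
  have hψ : act (tensorU u) (φ.symm (act W⁻¹ (φ ψ)) : StateSpace P) = (c : ℂ) • ψ := by
    rw [hc, LinearEquiv.apply_symm_apply, act_act_inv, LinearEquiv.symm_apply_apply]
  rw [eq_comm, ← act_inv_act (tensorU u) (_ • _), map_smul, hψ, smul_smul, ← Circle.coe_mul,
    inv_mul_cancel, Circle.coe_one, one_smul, map_inv]

theorem preservesCode (hu : Realizes φ u W) : PreservesCode σ (tensorU u) := by
  obtain ⟨c, hc⟩ := hu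
  intro ψ hψ
  rw [hc ⟨ψ, hψ⟩]
  exact (code σ).smul_mem _ (Subtype.mem _)

theorem exists_coe_eq_smul_one (hu : Realizes φ u W) {c : ℂ}
    (hscalar : ∀ ψ ∈ code σ, act (tensorU u) ψ = c • ψ) : ∃ e : ℂ, W.1 = e • 1 := by
  obtain ⟨z, hz⟩ := hu
  refine ⟨(z⁻¹ : Circle) * c, coe_eq_smul_one_iff.mpr fun χ => φ.symm.injective ?_⟩
  have hχ : c • (φ.symm χ : StateSpace P) = (z : ℂ) • φ.symm (act W χ) := by
    rw [← hscalar _ (φ.symm χ).2, hz, LinearEquiv.apply_symm_apply]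
  apply Subtype.ext
  rw [map_smul, Submodule.coe_smul, mul_smul, hχ, smul_smul, ← Circle.coe_mul, inv_mul_cancel,
    Circle.coe_one, one_smul]

end Realizes

theorem exists_act_tensorU_eq_smul_of_mem_scalarGroup {g : autGroup σ} (hg : g ∈ scalarGroup σ)
    (hu : ∀ p, Represents (u p) (g.1 p)) :
    ∃ c : ℂ, ∀ ψ ∈ code σ, act (tensorU u) ψ = c • ψ := by
  obtain ⟨u', hu', e, he⟩ := hg
  choose a ha using fun p => (hu' p).eq_smul (hu p)
  have htensor : (tensorU u).1 = (∏ p, a p) • (tensorU u').1 := by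
    rw [coe_tensorU, coe_tensorU, ← tensorMat_smul]
    exact congrArg tensorMat (funext ha)
  refine ⟨(∏ p, a p) * e, fun ψ hψ => ?_⟩
  rw [mul_smul, ← he ψ hψ]
  apply WithLp.ofLp_injective 2
  rw [ofLp_act, htensor, smul_mulVec, WithLp.ofLp_smul, ofLp_act]

variable (φ)

/-- The group of all transversally realisable logical operators. -/
def transversalGroup : Subgroup (UnitaryOn (Fin d)) where
  carrier := {W | ∃ u, Realizes φ u W}
  one_mem' := ⟨1, Realizes.one⟩
  mul_mem' := fun ⟨u, hu⟩ ⟨w, hw⟩ => ⟨u * w, hu.mul hw⟩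
  inv_mem' := fun ⟨u, hu⟩ => ⟨u⁻¹, hu.inv⟩

theorem phases_subset_transversalGroup : phases d ⊆ transversalGroup φ :=
  fun _ ⟨_, hc⟩ => ⟨1, Realizes.of_coe_eq_smul_one hc⟩

theorem continuous_act_tensorU_sub_smul (ψ : code σ) :
    Continuous fun x : ((P → U2) × Circle) × UnitaryOn (Fin d) =>
      act (tensorU x.1.1) (ψ : StateSpace P) -
        (x.1.2 : ℂ) • (φ.symm (act x.2 (φ ψ)) : StateSpace P) := by
  have hlogical : Continuous fun W : UnitaryOn (Fin d) =>
      (φ.symm (act W (φ ψ)) : StateSpace P) :=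
    continuous_subtype_val.comp ((LinearMap.continuous_of_finiteDimensional
      φ.symm.toLinearMap).comp (continuous_act (φ ψ)))
  have hphase : Continuous fun x : ((P → U2) × Circle) × UnitaryOn (Fin d) => (x.1.2 : ℂ) :=
    continuous_induced_dom.comp (continuous_snd.comp continuous_fst)
  exact ((continuous_act_tensorU _).comp (continuous_fst.comp continuous_fst)).sub
    (hphase.smul (hlogical.comp continuous_snd))

theorem isClosed_transversalGroup :
    IsClosed (transversalGroup φ : Set (UnitaryOn (Fin d))) := by
  have hclosed : IsClosed {x : ((P → U2) × Circle) × UnitaryOn (Fin d) | ∀ ψ : code σ,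
      act (tensorU x.1.1) (ψ : StateSpace P) -
        (x.1.2 : ℂ) • (φ.symm (act x.2 (φ ψ)) : StateSpace P) = 0} := by
    simp only [Set.ofPred_forall]
    exact isClosed_iInter fun ψ =>
      isClosed_eq (continuous_act_tensorU_sub_smul φ ψ) continuous_const
  convert isClosedMap_snd_of_compactSpace _ hclosed using 1
  ext W
  exact ⟨fun ⟨u, c, hc⟩ => ⟨((u, c), W), fun ψ => sub_eq_zero.mpr (hc ψ), rfl⟩,
    fun ⟨x, hx, hxW⟩ => hxW ▸ ⟨x.1.1, x.1.2, fun ψ => sub_eq_zero.mp (hx ψ)⟩⟩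

variable {φ}

theorem mem_transversalGroup_of_isApproxTransversal (hW : IsApproxTransversal σ φ W) :
    W ∈ transversalGroup φ := by
  let K (n : ℕ) : Set ((P → U2) × Circle) := {x | ∀ ψ : code σ,
    ‖act (tensorU x.1) (ψ : StateSpace P) - (x.2 : ℂ) • (φ.symm (act W (φ ψ)) : StateSpace P)‖ ≤
      1 / ((n : ℝ) + 1) * ‖ψ‖}
  have hclosed (n : ℕ) : IsClosed (K n) := by
    simp only [K, Set.ofPred_forall]
    exact isClosed_iInter fun ψ => isClosed_le ((continuous_act_tensorU_sub_smul φ ψ).comp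
      (continuous_id.prodMk continuous_const)).norm continuous_const
  have hne (n : ℕ) : (K n).Nonempty := by
    obtain ⟨u, c, hc, huc⟩ := hW (1 / ((n : ℝ) + 1)) (by positivity)
    exact ⟨(u, ⟨c, mem_sphere_zero_iff_norm.mpr hc⟩), huc⟩
  have hanti (n : ℕ) : K (n + 1) ⊆ K n := fun x hx ψ =>
    (hx ψ).trans (by gcongr; simp)
  obtain ⟨⟨u, c⟩, huc⟩ := IsCompact.nonempty_iInter_of_sequence_nonempty_isCompact_isClosed K hanti
    hne (hclosed 0).isCompact hclosed
  refine ⟨u, c, fun ψ => sub_eq_zero.mp (norm_le_zero_iff.mp ?_)⟩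
  have hlim : Filter.Tendsto (fun n : ℕ => 1 / ((n : ℝ) + 1) * ‖ψ‖) Filter.atTop (𝓝 0) := by
    simpa using tendsto_one_div_add_atTop_nhds_zero_nat.mul_const ‖ψ‖
  exact ge_of_tendsto' hlim fun n => Set.mem_iInter.mp huc n ψ

theorem oneQubitGate_mem_transversalGroup {j : Fin d} {𝒢 : Set (UnitaryOn (Fin d))}
    (huniv : IsUniversalOn j 𝒢) (h𝒢 : ∀ W ∈ 𝒢, IsApproxTransversal σ φ W) (x : U2) :
    oneQubitGate j x ∈ transversalGroup φ := by
  have hgen : 𝒢 ∪ phases d ⊆ transversalGroup φ :=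
    Set.union_subset (fun W hW => mem_transversalGroup_of_isApproxTransversal (h𝒢 W hW))
      (phases_subset_transversalGroup φ)
  exact closure_minimal ((Subgroup.closure_le _).mpr hgen) (isClosed_transversalGroup φ) (huniv x)

variable (φ)

/-- The triples of a local unitary operator, the rotations that it represents, and a logical
operator that it realises. -/
def realizationGroup : Subgroup ((P → U2) × (P → SO3) × UnitaryOn (Fin d)) where
  carrier := {x | (∀ p, Represents (x.1 p) (x.2.1 p)) ∧ Realizes φ x.1 x.2.2}
  one_mem' := ⟨fun _ => Represents.one, Realizes.one⟩
  mul_mem' hx hy := ⟨fun p => (hx.1 p).mul (hy.1 p), hx.2.mul hy.2⟩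
  inv_mem' hx := ⟨fun p => (hx.1 p).inv, hx.2.inv⟩

theorem isSolvable_transversalGroup [Group.IsSolvable (LogicalGroup σ)] :
    Group.IsSolvable (transversalGroup φ) := by
  let toLogicalOperator : realizationGroup φ →* transversalGroup φ :=
    { toFun x := ⟨x.1.2.2, x.1.1, x.2.2⟩
      map_one' := rfl
      map_mul' _ _ := rfl }
  let toAut : realizationGroup φ →* autGroup σ :=
    { toFun x := ⟨x.1.2.1, x.1.1, x.2.1, x.2.2.preservesCode⟩
      map_one' := rfl
      map_mul' _ _ := rfl }
  refine isSolvable_of_map_ker_le_center (f := toLogicalOperator)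
    (g := (QuotientGroup.mk' (scalarGroup σ)).comp toAut) ?_ ?_
  · rintro ⟨W, u, hu⟩
    choose g hg using fun p => exists_represents (u p)
    exact ⟨⟨(u, g, W), hg, hu⟩, rfl⟩
  · rintro _ ⟨x, hx, rfl⟩
    obtain ⟨c, hc⟩ := exists_act_tensorU_eq_smul_of_mem_scalarGroup
      ((QuotientGroup.eq_one_iff (toAut x)).mp hx) x.2.1
    obtain ⟨e, he⟩ := x.2.2.exists_coe_eq_smul_one hc
    refine Subgroup.mem_center_iff.mpr fun W => Subtype.ext (Subtype.ext ?_)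
    change W.1.1 * x.1.2.2.1 = x.1.2.2.1 * W.1.1
    rw [he, mul_smul_comm, smul_mul_assoc, mul_one, one_mul]

theorem oneQubitGate_injective (j : Fin d) : Function.Injective (oneQubitGate j) := by
  intro x y hxy
  apply Subtype.ext
  ext a b
  have hentry (x : U2) : (oneQubitGate j x).1 (Pi.single j a) (Pi.single j b) = x.1 a b := by
    rw [oneQubitGate, coe_tensorU, tensorMat, of_apply, Finset.prod_eq_single j]
    · simp only [Pi.mulSingle_eq_same, Pi.single_eq_same]
    · intro p _ hp
      rw [Pi.mulSingle_eq_of_ne hp, Pi.single_eq_of_ne hp, Pi.single_eq_of_ne hp]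
      exact one_apply_eq 0
    · exact fun hj => absurd (Finset.mem_univ j) hj
  rw [← hentry x, hxy, hentry]

theorem exists_oneQubitGate_notMem_transversalGroup [Group.IsSolvable (LogicalGroup σ)]
    (j : Fin d) : ∃ x, oneQubitGate j x ∉ transversalGroup φ := by
  by_contra! hmem
  have := isSolvable_transversalGroup φ
  let f : U2 →* transversalGroup φ :=
    (tensorU.comp (MonoidHom.mulSingle (fun _ : Fin d => U2) j)).codRestrict _ hmem
  have hf : Function.Injective f := fun x y hxy =>
    oneQubitGate_injective j (congrArg Subtype.val hxy)
  exact not_isSolvable_U2 (Group.isSolvable_of_isSolvable_injective hf)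

end Realization

end StabCode

end

theorem mainTheorem4 {P : Type*} [Fintype P] [DecidableEq P]
    (L : Submodule (ZMod 2) (P → StabCode.V)) (hL : StabCode.IsIsotropic L)
    (hzero : ¬ StabCode.SplitsOffZeroFactor L) (σ : StabCode.Sec L) :
    (Group.IsSolvable (StabCode.LogicalGroup σ) ∧
      StabCode.IsCompactLieGroup (StabCode.LogicalGroup σ)) ∧
    ∀ d : ℕ, Module.finrank (ZMod 2) L + d = Fintype.card P →
      ∀ (φ : StabCode.code σ ≃ₗ[ℂ] StabCode.StateSpace (Fin d)) (j : Fin d)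
        (𝒢 : Set (StabCode.UnitaryOn (Fin d))), StabCode.IsUniversalOn j 𝒢 →
        ¬ ∀ W ∈ 𝒢, StabCode.IsApproxTransversal σ φ W := by
  have hsolv := StabCode.isSolvable_logicalGroup hL hzero σ
  refine ⟨⟨hsolv, StabCode.isCompactLieGroup_logicalGroup hL hzero σ⟩, ?_⟩
  intro d _ φ j 𝒢 huniv h𝒢
  obtain ⟨x, hx⟩ := StabCode.exists_oneQubitGate_notMem_transversalGroup φ j
  exact hx (StabCode.oneQubitGate_mem_transversalGroup huniv h𝒢 x)
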